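/- **Setting.** Let $n\in\mathbb N$, $D=2n$, $\theta\in\mathbb R\setminus\{0\}$, and let $\Theta=\theta\,\mathrm{diag}(J,\dots,J)$ ($n$ blocks) with $J=\begin{pmatrix}0&-1\\1&0\end{pmatrix}$; $\Theta^{-1}_{\mu\nu}$ denotes the entries of $\Theta^{-1}$ and repeated indices are summed in the definition of $\xi_\mu$ below. On the Schwartz space $\mathcal S=\mathcal S(\mathbb R^{D})$ the Moyal product is $$(a\star b)(x)=\frac1{(\pi\theta)^{D}}\int\!\!\int a(x+y)\,b(x+z)\,e^{-2i\,y\Theta^{-1}z}\,dy\,dz .$$ For a tempered distribution $T\in\mathcal S'$ and $a\in\mathcal S$ put $\langle T\star a,f\rangle=\langle T,a\star f\rangle$ and $\langle a\star T,f\rangle=\langle T,f\star a\rangle$ ($f\in\mathcal S$). The Moyal algebra is $\mathcal M=\{T\in\mathcal S' : a\star T\in\mathcal S \text{ and } T\star a\in\mathcal S \text{ for all } a\in\mathcal S\}$, a unital associative complex algebra with product $\langle S\star T,a\rangle=\langle S,T\star a\rangle$ and centre $\mathbb C$. It contains all polynomial functions. Write $[a,b]_\star=a\star b-b\star a$ and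 $\mathrm{ad}_a(b)=[a,b]_\star$. Let $\mathcal P_2\subset\mathcal M$ be the Lie algebra (for $[\cdot,\cdot]_\star$) of complex polynomial functions of degree $\le2$, let $\mathcal G_2=\{\mathrm{ad}_P : P\in\mathcal P_2\}$, a Lie algebra of derivations of $\mathcal M$, and let $\eta:\mathcal G_2\to\mathcal M$ be the (well-defined) linear map $\eta(\mathrm{ad}_P)=P-P(0)$. Put $\xi_\mu=-\Theta^{-1}_{\mu\nu}x_\nu$, $\partial_\mu=\mathrm{ad}_{i\xi_\mu}$ and $X_{(\mu\nu)}=X_{(\nu\mu)}=\mathrm{ad}_{i\xi_\mu\xi_\nu}$ (commutative product of functions), for $\mu,\nu=1,\dots,D$. A connection on the right module $\mathcal M$ over $\mathcal M$ (for the differential calculus based on $\mathcal G_2$) is a linear map $X\mapsto\nabla_X$ from $\mathcal G_2$ to the linear endomorphisms of $\mathcal M$ with $\nabla_X(m\star a)=m\star X(a)+\nabla_X(m)\star a$. Its curvature is $F(X,Y)=[\nabla_X,\nabla_Y]-\nabla_{[X,Y]}$. The canonical connection is $\nabla^{inv}_X(a)=X(a)-\eta(X)\star a$. The tensor $1$-form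 of $\nabla$ is the linear map $\mathcal A:\mathcal G_2\to\mathcal M$, $\mathcal A(X)=\nabla_X(1)+\eta(X)$, with components $\mathcal A_\mu=\mathcal A(\partial_\mu)$ and $\mathcal A_{(\mu\nu)}=\mathcal A(X_{(\mu\nu)})$. An element $F\in\mathcal M$ is identified with the operator $a\mapsto F\star a$ on $\mathcal M$. **Proposition.** (1) The $\partial_\mu$, together with the $X_{(\mu\nu)}$ for unordered pairs $\mu,\nu$ (with $\mu=\nu$ allowed), form a basis of the complex vector space $\mathcal G_2$, and they satisfy the commutation relations, with real structure constants, of the inhomogeneous symplectic Lie algebra $isp(2n)$: $$[\partial_\mu,\partial_\nu]=0,\qquad [\partial_\mu,X_{(\rho\sigma)}]=\Theta^{-1}_{\mu\rho}\partial_\sigma+\Theta^{-1}_{\mu\sigma}\partial_\rho,$$ $$[X_{(\mu\nu)},X_{(\rho\sigma)}]=-\big(\Theta^{-1}_{\rho\nu}X_{(\mu\sigma)}+\Theta^{-1}_{\sigma\nu}X_{(\mu\rho)}+\Theta^{-1}_{\rho\mu}X_{(\nu\sigma)}+\Theta^{-1}_{\sigma\mu}X_{(\nu\rho)}\big).$$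 (2) Connections are in bijection with linear maps $\mathcal A:\mathcal G_2\to\mathcal M$ via $\nabla\mapsto\mathcal A$, and $\nabla_X(a)=\nabla^{inv}_X(a)+\mathcal A(X)\star a$ for all $X\in\mathcal G_2$, $a\in\mathcal M$. (3) The components of the curvature of the connection with tensor $1$-form $\mathcal A$ are, for all indices, $$F(\partial_\mu,\partial_\nu)=[\mathcal A_\mu,\mathcal A_\nu]_\star-i\Theta^{-1}_{\mu\nu},$$ $$F(\partial_\mu,X_{(\rho\sigma)})=[\mathcal A_\mu,\mathcal A_{(\rho\sigma)}]_\star-\Theta^{-1}_{\mu\rho}\mathcal A_\sigma-\Theta^{-1}_{\mu\sigma}\mathcal A_\rho,$$ $$F(X_{(\mu\nu)},X_{(\rho\sigma)})=[\mathcal A_{(\mu\nu)},\mathcal A_{(\rho\sigma)}]_\star+\Theta^{-1}_{\rho\nu}\mathcal A_{(\mu\sigma)}+\Theta^{-1}_{\sigma\nu}\mathcal A_{(\mu\rho)}+\Theta^{-1}_{\rho\mu}\mathcal A_{(\nu\sigma)}+\Theta^{-1}_{\sigma\mu}\mathcal A_{(\nu\rho)}.$$ (4) The curvature of the canonical connection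 is $F^{inv}(\partial_\mu,\partial_\nu)=-i\Theta^{-1}_{\mu\nu}$, $F^{inv}(\partial_\mu,X_{(\rho\sigma)})=0$ and $F^{inv}(X_{(\mu\nu)},X_{(\rho\sigma)})=0$. -/

import Mathlib

open MeasureTheory SchwartzMap Filter Topology
open scoped LineDeriv FourierTransform ContDiff

attribute [local instance] LieRing.ofAssociativeRing

namespace Moyal

noncomputable section

section Twisted

variable {ι : Type*} [Fintype ι]

/-- Multiplication of a Schwartz function by the linear function `x ↦ ⟪x, v⟫`. -/
def mulCoord (v : EuclideanSpace ℝ ι) :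
    𝓢(EuclideanSpace ℝ ι, ℂ) →L[ℂ] 𝓢(EuclideanSpace ℝ ι, ℂ) :=
  SchwartzMap.smulLeftCLM ℂ (fun x => ((inner ℝ x v : ℝ) : ℂ))

theorem mulCoord_apply (v : EuclideanSpace ℝ ι) (a : 𝓢(EuclideanSpace ℝ ι, ℂ))
    (x : EuclideanSpace ℝ ι) : mulCoord v a x = ((inner ℝ x v : ℝ) : ℂ) * a x := by
  have h : Function.HasTemperateGrowth
      (fun x : EuclideanSpace ℝ ι => ((inner ℝ x v : ℝ) : ℂ)) := by fun_prop
  simp [mulCoord, SchwartzMap.smulLeftCLM_apply_apply h]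

/-- Multiplication by the exponent `2 i ⟪y, B v⟫`. -/
def mulPhase (B : EuclideanSpace ℝ ι ≃L[ℝ] EuclideanSpace ℝ ι) (v : EuclideanSpace ℝ ι) :
    𝓢(EuclideanSpace ℝ ι, ℂ) →L[ℂ] 𝓢(EuclideanSpace ℝ ι, ℂ) :=
  (2 * Complex.I) • mulCoord (B v)

theorem mulPhase_apply (B : EuclideanSpace ℝ ι ≃L[ℝ] EuclideanSpace ℝ ι) (v : EuclideanSpace ℝ ι)
    (a : 𝓢(EuclideanSpace ℝ ι, ℂ)) (x : EuclideanSpace ℝ ι) :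
    mulPhase B v a x = 2 * Complex.I * ((inner ℝ x (B v) : ℝ) : ℂ) * a x := by
  simp [mulPhase, mulCoord_apply, mul_assoc]

/-- The phase `exp (2 i ⟪y, B x⟫)`. -/
def phase (B : EuclideanSpace ℝ ι ≃L[ℝ] EuclideanSpace ℝ ι) (y x : EuclideanSpace ℝ ι) : ℂ :=
  Complex.exp (2 * Complex.I * ((inner ℝ y (B x) : ℝ) : ℂ))

variable (B : EuclideanSpace ℝ ι ≃L[ℝ] EuclideanSpace ℝ ι)

theorem norm_phase (y x : EuclideanSpace ℝ ι) : ‖phase B y x‖ = 1 := by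
  have : (2 * Complex.I * ((inner ℝ y (B x) : ℝ) : ℂ)) =
      ((2 * inner ℝ y (B x) : ℝ) : ℂ) * Complex.I := by push_cast; ring
  rw [phase, this, Complex.norm_exp_ofReal_mul_I]

@[fun_prop]
theorem continuous_phase {X : Type*} [TopologicalSpace X] {f g : X → EuclideanSpace ℝ ι}
    (hf : Continuous f) (hg : Continuous g) : Continuous fun z => phase B (f z) (g z) := by
  unfold phase
  fun_prop

theorem hasFDerivAt_phase (y x : EuclideanSpace ℝ ι) :
    HasFDerivAt (fun x => phase B y x)
      ((2 * Complex.I * phase B y x) • (Complex.ofRealCLM ∘L (innerSL ℝ y) ∘L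
        (B : EuclideanSpace ℝ ι →L[ℝ] EuclideanSpace ℝ ι))) x := by
  have h1 : HasFDerivAt (fun x => ((inner ℝ y (B x) : ℝ) : ℂ))
      (Complex.ofRealCLM ∘L (innerSL ℝ y) ∘L (B : EuclideanSpace ℝ ι →L[ℝ] EuclideanSpace ℝ ι)) x :=
    (Complex.ofRealCLM ∘L (innerSL ℝ y) ∘L
      (B : EuclideanSpace ℝ ι →L[ℝ] EuclideanSpace ℝ ι)).hasFDerivAt
  have h2 := (h1.const_mul (2 * Complex.I)).cexp
  refine h2.congr_fderiv ?_
  ext v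
  simp [phase]
  ring

/-- The integral `∫ a (x + y) exp (2 i ⟪y, B x⟫) h y dy`. -/
def tw (a h : 𝓢(EuclideanSpace ℝ ι, ℂ)) (x : EuclideanSpace ℝ ι) : ℂ :=
  ∫ y, a (x + y) * phase B y x * h y

theorem integrable_tw (a h : 𝓢(EuclideanSpace ℝ ι, ℂ)) (x : EuclideanSpace ℝ ι) :
    Integrable fun y => a (x + y) * phase B y x * h y := by
  refine Integrable.bdd_mul (c := SchwartzMap.seminorm ℝ 0 0 a) h.integrable
    (Continuous.aestronglyMeasurable (by fun_prop)) (ae_of_all _ fun y => ?_)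
  rw [norm_mul, norm_phase, mul_one]
  exact a.norm_le_seminorm ℝ (x + y)

theorem norm_tw_le (a h : 𝓢(EuclideanSpace ℝ ι, ℂ)) (x : EuclideanSpace ℝ ι) :
    ‖tw B a h x‖ ≤ SchwartzMap.seminorm ℝ 0 0 a * ∫ y, ‖h y‖ := by
  rw [tw, ← integral_const_mul]
  refine norm_integral_le_of_norm_le (h.integrable.norm.const_mul _) (ae_of_all _ fun y => ?_)
  rw [norm_mul, norm_mul, norm_phase, mul_one]
  exact mul_le_mul_of_nonneg_right (a.norm_le_seminorm ℝ (x + y)) (norm_nonneg _)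

theorem tw_mulCoord (v : EuclideanSpace ℝ ι) (a h : 𝓢(EuclideanSpace ℝ ι, ℂ))
    (x : EuclideanSpace ℝ ι) :
    ((inner ℝ x v : ℝ) : ℂ) * tw B a h x =
      tw B (mulCoord v a) h x - tw B a (mulCoord v h) x := by
  rw [tw, tw, tw, ← integral_const_mul, ← integral_sub (integrable_tw B _ _ _)
    (integrable_tw B _ _ _)]
  refine integral_congr_ae (ae_of_all _ fun y => ?_)
  simp only [mulCoord_apply, inner_add_left]
  push_cast
  ring

theorem hasFDerivAt_tw (a h : 𝓢(EuclideanSpace ℝ ι, ℂ)) (x : EuclideanSpace ℝ ι) :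
    ∃ L : EuclideanSpace ℝ ι →L[ℝ] ℂ, HasFDerivAt (tw B a h) L x ∧
      ∀ v, L v = tw B (∂_{v} a) h x + tw B a (mulPhase B v h) x := by
  classical
  let F' : EuclideanSpace ℝ ι → EuclideanSpace ℝ ι → (EuclideanSpace ℝ ι →L[ℝ] ℂ) := fun x y =>
    (phase B y x * h y) • fderiv ℝ a (x + y) +
    (a (x + y) * h y) • (2 * Complex.I * phase B y x) • (Complex.ofRealCLM ∘L (innerSL ℝ y) ∘L
      (B : EuclideanSpace ℝ ι →L[ℝ] EuclideanSpace ℝ ι))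
  have hF'v : ∀ x y v, F' x y v =
      (∂_{v} a) (x + y) * phase B y x * h y + a (x + y) * phase B y x * (mulPhase B v h) y := by
    intro x y v
    simp [F', mulPhase_apply, SchwartzMap.lineDerivOp_apply_eq_fderiv]
    ring
  have hcont : Continuous (F' x) := by
    have h1 : Continuous (fderiv ℝ a) := (a.smooth 1).continuous_fderiv (by simp)
    fun_prop
  let bound : EuclideanSpace ℝ ι → ℝ := fun y =>
    SchwartzMap.seminorm ℝ 0 1 a * ‖h y‖ +
      SchwartzMap.seminorm ℝ 0 0 a * (2 * ‖(B : EuclideanSpace ℝ ι →L[ℝ] EuclideanSpace ℝ ι)‖) *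
        (‖y‖ ^ 1 * ‖h y‖)
  have hbi : Integrable bound :=
    (h.integrable.norm.const_mul _).add ((h.integrable_pow_mul volume 1).const_mul _)
  have hb : ∀ x y, ‖F' x y‖ ≤ bound y := by
    intro x y
    refine (norm_add_le _ _).trans (add_le_add ?_ ?_)
    · rw [norm_smul, norm_mul, norm_phase, one_mul, mul_comm]
      refine mul_le_mul_of_nonneg_right ?_ (norm_nonneg _)
      have := a.norm_iteratedFDeriv_le_seminorm ℝ 1 (x + y)
      rwa [norm_iteratedFDeriv_one] at this
    · rw [norm_smul, norm_mul, norm_smul, norm_mul, norm_phase]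
      have h1 : ‖(Complex.ofRealCLM ∘L (innerSL ℝ y) ∘L
          (B : EuclideanSpace ℝ ι →L[ℝ] EuclideanSpace ℝ ι))‖ ≤
          ‖y‖ * ‖(B : EuclideanSpace ℝ ι →L[ℝ] EuclideanSpace ℝ ι)‖ := by
        refine (ContinuousLinearMap.opNorm_comp_le _ _).trans ?_
        rw [Complex.ofRealCLM_norm, one_mul]
        refine (ContinuousLinearMap.opNorm_comp_le _ _).trans ?_
        rw [innerSL_apply_norm]
      have h2 := a.norm_le_seminorm ℝ (x + y)
      have h3 : ‖(2 * Complex.I : ℂ)‖ = 2 := by simp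
      rw [h3, mul_one]
      calc _ ≤ SchwartzMap.seminorm ℝ 0 0 a * ‖h y‖ * (2 * (‖y‖ *
            ‖(B : EuclideanSpace ℝ ι →L[ℝ] EuclideanSpace ℝ ι)‖)) := by gcongr
        _ = _ := by ring
  have key := hasFDerivAt_integral_of_dominated_of_fderiv_le (𝕜 := ℝ) (μ := volume)
    (F := fun x y => a (x + y) * phase B y x * h y) (F' := F') (x₀ := x) (s := Set.univ)
    (bound := bound) univ_mem
    (Eventually.of_forall fun x => (integrable_tw B a h x).aestronglyMeasurable)
    (integrable_tw B a h x) hcont.aestronglyMeasurable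
    (ae_of_all _ fun y x _ => hb x y) hbi
    (ae_of_all _ fun y x _ => by
      have h1 : HasFDerivAt (fun x => a (x + y)) (fderiv ℝ a (x + y)) x :=
        (hasFDerivAt_comp_add_right y).2 (a.hasFDerivAt (x + y))
      have h2 := (h1.mul (hasFDerivAt_phase B y x)).mul_const (h y)
      refine h2.congr_fderiv ?_
      ext v
      simp [F']
      ring)
  refine ⟨_, key, fun v => ?_⟩
  have hint : Integrable (F' x) := hbi.mono' hcont.aestronglyMeasurable (ae_of_all _ (hb x))
  rw [ContinuousLinearMap.integral_apply hint, tw, tw,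
    ← integral_add (integrable_tw B _ _ _) (integrable_tw B _ _ _)]
  exact integral_congr_ae (ae_of_all _ fun y => hF'v x y v)

end Twisted

end

end Moyal

namespace Moyal

noncomputable section

section Twisted2

variable {ι : Type*} [Fintype ι]

/-- The standard basis vectors. -/
abbrev basisVec (μ : ι) : EuclideanSpace ℝ ι := EuclideanSpace.basisFun ι ℝ μ

theorem sum_basisVec (x : EuclideanSpace ℝ ι) : ∑ μ, inner ℝ x (basisVec μ) • basisVec μ = x := by
  simp_rw [real_inner_comm (basisVec _) x]
  exact (EuclideanSpace.basisFun ι ℝ).sum_repr' x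

theorem norm_pow_succ_mul_le (x : EuclideanSpace ℝ ι) (k : ℕ) (c : ℂ) :
    ‖x‖ ^ (k + 1) * ‖c‖ ≤ ∑ μ, ‖x‖ ^ k * ‖((inner ℝ x (basisVec μ) : ℝ) : ℂ) * c‖ := by
  have h : ‖x‖ ≤ ∑ μ, |inner ℝ x (basisVec μ)| := by
    conv_lhs => rw [← sum_basisVec x]
    refine (norm_sum_le _ _).trans (Finset.sum_le_sum fun μ _ => ?_)
    rw [norm_smul, (EuclideanSpace.basisFun ι ℝ).norm_eq_one, mul_one, Real.norm_eq_abs]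
  calc ‖x‖ ^ (k + 1) * ‖c‖ = ‖x‖ * (‖x‖ ^ k * ‖c‖) := by ring
    _ ≤ (∑ μ, |inner ℝ x (basisVec μ)|) * (‖x‖ ^ k * ‖c‖) := by gcongr
    _ = _ := by
      rw [Finset.sum_mul]
      refine Finset.sum_congr rfl fun μ _ => ?_
      rw [norm_mul, Complex.norm_real, Real.norm_eq_abs]
      ring

/-- `z ↦ (v ↦ ⟪v, e_μ⟫ z)`. -/
def coordSmul (μ : ι) : ℂ →L[ℝ] (EuclideanSpace ℝ ι →L[ℝ] ℂ) :=
  ContinuousLinearMap.smulRightL ℝ (EuclideanSpace ℝ ι) ℂ (innerSL ℝ (basisVec μ))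

theorem clm_eq_sum (L : EuclideanSpace ℝ ι →L[ℝ] ℂ) :
    L = ∑ μ, coordSmul μ (L (basisVec μ)) := by
  ext v
  conv_lhs => rw [← sum_basisVec v]
  simp [coordSmul]

theorem norm_iteratedFDeriv_succ_le {f : EuclideanSpace ℝ ι → ℂ} {g : ι → EuclideanSpace ℝ ι → ℂ}
    (hg : ∀ μ, ContDiff ℝ ∞ (g μ)) (hf : ∀ x, HasFDerivAt f (∑ μ, coordSmul μ (g μ x)) x)
    (l : ℕ) (x : EuclideanSpace ℝ ι) :
    ‖iteratedFDeriv ℝ (l + 1) f x‖ ≤ ∑ μ, ‖iteratedFDeriv ℝ l (g μ) x‖ := by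
  rw [← norm_iteratedFDeriv_fderiv]
  have h1 : fderiv ℝ f = fun x => ∑ μ, (coordSmul μ ∘ g μ) x := by
    ext1 x
    rw [(hf x).fderiv]
    rfl
  have hle : ((l : ℕ∞) : WithTop ℕ∞) ≤ (∞ : WithTop ℕ∞) := by exact_mod_cast le_top
  rw [h1, iteratedFDeriv_fun_sum_apply (fun μ _ =>
    (((coordSmul μ).contDiff.comp (hg μ)).of_le hle).contDiffAt)]
  refine (norm_sum_le _ _).trans (Finset.sum_le_sum fun μ _ => ?_)
  refine ((coordSmul μ).norm_iteratedFDeriv_comp_left (hg μ).contDiffAt hle).trans ?_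
  have : ‖coordSmul μ‖ ≤ 1 := by
    rw [coordSmul, ContinuousLinearMap.norm_smulRightL, innerSL_apply_norm,
      (EuclideanSpace.basisFun ι ℝ).norm_eq_one]
  exact mul_le_of_le_one_left (norm_nonneg _) this

variable (B : EuclideanSpace ℝ ι ≃L[ℝ] EuclideanSpace ℝ ι)

theorem hasFDerivAt_tw' (a h : 𝓢(EuclideanSpace ℝ ι, ℂ)) (x : EuclideanSpace ℝ ι) :
    HasFDerivAt (tw B a h) (∑ μ, coordSmul μ (tw B (∂_{basisVec μ} a) h x +
      tw B a (mulPhase B (basisVec μ) h) x)) x := by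
  obtain ⟨L, hL, hLv⟩ := hasFDerivAt_tw B a h x
  convert hL using 1
  rw [clm_eq_sum L]
  simp_rw [hLv]

theorem contDiff_tw (a h : 𝓢(EuclideanSpace ℝ ι, ℂ)) : ContDiff ℝ ∞ (tw B a h) := by
  rw [contDiff_infty]
  intro n
  induction n generalizing a h with
  | zero =>
    rw [Nat.cast_zero, contDiff_zero, continuous_iff_continuousAt]
    exact fun x => (hasFDerivAt_tw' B a h x).continuousAt
  | succ n ih =>
    rw [Nat.cast_succ, contDiff_succ_iff_hasFDerivAt]
    refine ⟨_, ?_, hasFDerivAt_tw' B a h⟩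
    exact ContDiff.sum fun μ _ => (coordSmul μ).contDiff.comp ((ih _ _).add (ih _ _))

theorem seminorm_sum_apply {κ V : Type*} [AddCommGroup V] [Module ℂ V] (s : Finset κ)
    (p : κ → Seminorm ℂ V) (a : V) : (∑ μ ∈ s, p μ) a = ∑ μ ∈ s, p μ a := by
  classical
  induction s using Finset.induction_on with
  | empty => simp
  | insert i s hi ih => rw [Finset.sum_insert hi, Finset.sum_insert hi, add_apply, ih]

/-- A bilinear estimate by continuous seminorms is stable under sums over coordinates. -/
theorem comb_bound (p q : Seminorm ℂ 𝓢(EuclideanSpace ℝ ι, ℂ)) (hp : Continuous p)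
    (hq : Continuous q)
    (A A' : ι → 𝓢(EuclideanSpace ℝ ι, ℂ) →L[ℂ] 𝓢(EuclideanSpace ℝ ι, ℂ)) :
    ∃ p' q' : Seminorm ℂ 𝓢(EuclideanSpace ℝ ι, ℂ), Continuous p' ∧ Continuous q' ∧
      ∀ a h, ∑ μ, (p (A μ a) * q h + p a * q (A' μ h)) ≤ p' a * q' h := by
  refine ⟨p + ∑ μ, p.comp (A μ).toLinearMap, q + ∑ μ, q.comp (A' μ).toLinearMap, ?_, ?_, ?_⟩
  · rw [FunLike.coe_add]
    refine hp.add ?_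
    have : ⇑(∑ μ, p.comp (A μ).toLinearMap) = fun a => ∑ μ, p (A μ a) := by
      ext a; simp
    rw [this]
    exact continuous_finsetSum _ fun μ _ => hp.comp (A μ).continuous
  · rw [FunLike.coe_add]
    refine hq.add ?_
    have : ⇑(∑ μ, q.comp (A' μ).toLinearMap) = fun a => ∑ μ, q (A' μ a) := by
      ext a; simp
    rw [this]
    exact continuous_finsetSum _ fun μ _ => hq.comp (A' μ).continuous
  · intro a h
    simp only [add_apply, seminorm_sum_apply]
    rw [Finset.sum_add_distrib, ← Finset.sum_mul, ← Finset.mul_sum]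
    have h1 : 0 ≤ ∑ μ, p (A μ a) := Finset.sum_nonneg fun μ _ => apply_nonneg _ _
    have h2 : 0 ≤ ∑ μ, q (A' μ h) := Finset.sum_nonneg fun μ _ => apply_nonneg _ _
    have h3 := apply_nonneg p a
    have h4 := apply_nonneg q h
    change (∑ μ, p (A μ a)) * q h + p a * (∑ μ, q (A' μ h)) ≤
      (p a + ∑ μ, p (A μ a)) * (q h + ∑ μ, q (A' μ h))
    nlinarith [mul_nonneg h3 h4, mul_nonneg h1 h2]

theorem tw_bound (k l : ℕ) : ∃ p q : Seminorm ℂ 𝓢(EuclideanSpace ℝ ι, ℂ),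
    Continuous p ∧ Continuous q ∧
      ∀ a h x, ‖x‖ ^ k * ‖iteratedFDeriv ℝ l (tw B a h) x‖ ≤ p a * q h := by
  have hS : WithSeminorms (schwartzSeminormFamily ℂ (EuclideanSpace ℝ ι) ℂ) :=
    schwartz_withSeminorms ℂ _ _
  induction l with
  | zero =>
    simp_rw [norm_iteratedFDeriv_zero]
    induction k with
    | zero =>
      refine ⟨SchwartzMap.seminorm ℂ 0 0,
        (normSeminorm ℂ (Lp ℂ 1 (volume : Measure (EuclideanSpace ℝ ι)))).comp
          (SchwartzMap.toLpCLM ℂ ℂ 1 volume).toLinearMap,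
        hS.continuous_seminorm (0, 0), ?_, fun a h x => ?_⟩
      · exact continuous_norm.comp (SchwartzMap.toLpCLM ℂ ℂ 1 volume).continuous
      · rw [pow_zero, one_mul]
        refine (norm_tw_le B a h x).trans (mul_le_mul_of_nonneg_left (le_of_eq ?_)
          (apply_nonneg _ _))
        exact (SchwartzMap.norm_toLp_one).symm
    | succ k ih =>
      obtain ⟨p, q, hp, hq, hb⟩ := ih
      obtain ⟨p', q', hp', hq', hb'⟩ := comb_bound p q hp hq
        (fun μ => mulCoord (basisVec μ)) (fun μ => mulCoord (basisVec μ))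
      refine ⟨p', q', hp', hq', fun a h x => (norm_pow_succ_mul_le x k _).trans
        ((Finset.sum_le_sum fun μ _ => ?_).trans (hb' a h))⟩
      rw [tw_mulCoord]
      refine (mul_le_mul_of_nonneg_left (norm_sub_le _ _) (by positivity)).trans ?_
      rw [mul_add]
      exact add_le_add (hb _ _ _) (hb _ _ _)
  | succ l ih =>
    obtain ⟨p, q, hp, hq, hb⟩ := ih
    obtain ⟨p', q', hp', hq', hb'⟩ := comb_bound p q hp hq
      (fun μ => LineDeriv.lineDerivOpCLM ℂ 𝓢(EuclideanSpace ℝ ι, ℂ) (basisVec μ))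
      (fun μ => mulPhase B (basisVec μ))
    refine ⟨p', q', hp', hq', fun a h x => ?_⟩
    have h1 := norm_iteratedFDeriv_succ_le
      (fun μ => (contDiff_tw B (∂_{basisVec μ} a) h).add
        (contDiff_tw B a (mulPhase B (basisVec μ) h)))
      (hasFDerivAt_tw' B a h) l x
    refine (mul_le_mul_of_nonneg_left h1 (by positivity)).trans ?_
    rw [Finset.mul_sum]
    refine (Finset.sum_le_sum fun μ _ => ?_).trans (hb' a h)
    have hle : ((l : ℕ∞) : WithTop ℕ∞) ≤ (∞ : WithTop ℕ∞) := by exact_mod_cast le_top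
    rw [fun_iteratedFDeriv_add ((contDiff_tw B _ _).of_le hle) ((contDiff_tw B _ _).of_le hle)]
    refine (mul_le_mul_of_nonneg_left (norm_add_le _ _) (by positivity)).trans ?_
    rw [mul_add]
    exact add_le_add (hb _ _ _) (hb _ _ _)

/-- The twisted integral as a Schwartz function. -/
def twS (a h : 𝓢(EuclideanSpace ℝ ι, ℂ)) : 𝓢(EuclideanSpace ℝ ι, ℂ) where
  toFun := tw B a h
  smooth' := contDiff_tw B a h
  decay' k l := by
    obtain ⟨p, q, -, -, hb⟩ := tw_bound B k l
    exact ⟨_, hb a h⟩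

theorem twS_apply (a h : 𝓢(EuclideanSpace ℝ ι, ℂ)) (x : EuclideanSpace ℝ ι) :
    twS B a h x = ∫ y, a (x + y) * phase B y x * h y := rfl

theorem twS_add_left (a b h : 𝓢(EuclideanSpace ℝ ι, ℂ)) :
    twS B (a + b) h = twS B a h + twS B b h := by
  ext x
  rw [add_apply, twS_apply, twS_apply, twS_apply,
    ← integral_add (integrable_tw B _ _ _) (integrable_tw B _ _ _)]
  congr 1; ext y; rw [add_apply]; ring

theorem twS_add_right (a h k : 𝓢(EuclideanSpace ℝ ι, ℂ)) :
    twS B a (h + k) = twS B a h + twS B a k := by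
  ext x
  rw [add_apply, twS_apply, twS_apply, twS_apply,
    ← integral_add (integrable_tw B _ _ _) (integrable_tw B _ _ _)]
  congr 1; ext y; rw [add_apply]; ring

theorem twS_smul_left (c : ℂ) (a h : 𝓢(EuclideanSpace ℝ ι, ℂ)) :
    twS B (c • a) h = c • twS B a h := by
  ext x
  rw [smul_apply, twS_apply, twS_apply, smul_eq_mul, ← integral_const_mul]
  congr 1; ext y; rw [smul_apply, smul_eq_mul]; ring

theorem twS_smul_right (c : ℂ) (a h : 𝓢(EuclideanSpace ℝ ι, ℂ)) :
    twS B a (c • h) = c • twS B a h := by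
  ext x
  rw [smul_apply, twS_apply, twS_apply, smul_eq_mul, ← integral_const_mul]
  congr 1; ext y; rw [smul_apply, smul_eq_mul]; ring

/-- The twisted integral as a bilinear map. -/
def twLM : 𝓢(EuclideanSpace ℝ ι, ℂ) →ₗ[ℂ] 𝓢(EuclideanSpace ℝ ι, ℂ) →ₗ[ℂ]
    𝓢(EuclideanSpace ℝ ι, ℂ) :=
  LinearMap.mk₂ ℂ (twS B) (twS_add_left B) (twS_smul_left B) (twS_add_right B) (twS_smul_right B)

theorem seminorm_twS_le (k l : ℕ) : ∃ p q : Seminorm ℂ 𝓢(EuclideanSpace ℝ ι, ℂ),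
    Continuous p ∧ Continuous q ∧ ∀ a h, SchwartzMap.seminorm ℂ k l (twS B a h) ≤ p a * q h := by
  obtain ⟨p, q, hp, hq, hb⟩ := tw_bound B k l
  exact ⟨p, q, hp, hq, fun a h => SchwartzMap.seminorm_le_bound ℂ k l _
    (mul_nonneg (apply_nonneg _ _) (apply_nonneg _ _)) (hb a h)⟩

theorem continuous_twS_right (a : 𝓢(EuclideanSpace ℝ ι, ℂ)) : Continuous (twS B a) := by
  refine (schwartz_withSeminorms ℂ (EuclideanSpace ℝ ι) ℂ).continuous_of_continuous_comp
    (twLM B a) fun i => ?_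
  obtain ⟨p, q, -, hq, hb⟩ := seminorm_twS_le B i.1 i.2
  let r : NNReal := ⟨p a, apply_nonneg _ _⟩
  refine Seminorm.continuous_of_le (q := r • q) (hq.const_smul r) fun h => hb a h

theorem continuous_twS_left (h : 𝓢(EuclideanSpace ℝ ι, ℂ)) : Continuous fun a => twS B a h := by
  refine (schwartz_withSeminorms ℂ (EuclideanSpace ℝ ι) ℂ).continuous_of_continuous_comp
    ((twLM B).flip h) fun i => ?_
  obtain ⟨p, q, hp, -, hb⟩ := seminorm_twS_le B i.1 i.2
  let r : NNReal := ⟨q h, apply_nonneg _ _⟩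
  refine Seminorm.continuous_of_le (q := r • p) (hp.const_smul r) fun a => ?_
  refine (hb a h).trans (le_of_eq (mul_comm _ _))

theorem mulCoord_twS (v : EuclideanSpace ℝ ι) (a h : 𝓢(EuclideanSpace ℝ ι, ℂ)) :
    mulCoord v (twS B a h) = twS B (mulCoord v a) h - twS B a (mulCoord v h) := by
  ext x
  rw [mulCoord_apply, sub_apply]
  exact tw_mulCoord B v a h x

theorem lineDeriv_twS (v : EuclideanSpace ℝ ι) (a h : 𝓢(EuclideanSpace ℝ ι, ℂ)) :
    ∂_{v} (twS B a h) = twS B (∂_{v} a) h + twS B a (mulPhase B v h) := by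
  ext x
  obtain ⟨L, hL, hLv⟩ := hasFDerivAt_tw B a h x
  rw [SchwartzMap.lineDerivOp_apply_eq_fderiv, add_apply]
  exact (congrArg (fun M => M v) (show HasFDerivAt (twS B a h) L x from hL).fderiv).trans (hLv v)

end Twisted2

end

end Moyal

namespace Moyal

noncomputable section

section Approx

variable {ι : Type*} [Fintype ι]

theorem seminorm_succ_left_le (k : ℕ) (g : 𝓢(EuclideanSpace ℝ ι, ℂ)) :
    SchwartzMap.seminorm ℂ (k + 1) 0 g ≤
      ∑ μ, SchwartzMap.seminorm ℂ k 0 (mulCoord (basisVec μ) g) := by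
  refine SchwartzMap.seminorm_le_bound ℂ _ _ _ (Finset.sum_nonneg fun _ _ => apply_nonneg _ _)
    fun x => ?_
  rw [norm_iteratedFDeriv_zero]
  refine (norm_pow_succ_mul_le x k _).trans (Finset.sum_le_sum fun μ _ => ?_)
  rw [← mulCoord_apply]
  exact SchwartzMap.norm_pow_mul_le_seminorm ℂ _ k x

theorem seminorm_succ_right_le (k l : ℕ) (g : 𝓢(EuclideanSpace ℝ ι, ℂ)) :
    SchwartzMap.seminorm ℂ k (l + 1) g ≤
      ∑ μ : ι, SchwartzMap.seminorm ℂ k l (∂_{(basisVec μ : EuclideanSpace ℝ ι)} g :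
        𝓢(EuclideanSpace ℝ ι, ℂ)) := by
  refine SchwartzMap.seminorm_le_bound ℂ _ _ _ (Finset.sum_nonneg fun _ _ => apply_nonneg _ _)
    fun x => ?_
  have h1 := norm_iteratedFDeriv_succ_le (f := g)
    (g := fun μ => (∂_{(basisVec μ : EuclideanSpace ℝ ι)} g : 𝓢(EuclideanSpace ℝ ι, ℂ)))
    (fun μ => SchwartzMap.smooth _ ⊤)
    (fun x => (g.hasFDerivAt x).congr_fderiv (clm_eq_sum (fderiv ℝ g x))) l x
  refine (mul_le_mul_of_nonneg_left h1 (by positivity)).trans ?_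
  rw [Finset.mul_sum]
  exact Finset.sum_le_sum fun μ _ => SchwartzMap.le_seminorm ℂ k l _ x

/-- The rescaling `h ↦ t ^ D h (t ·)`. -/
def rescale (t : ℝ) (ht : t ≠ 0) :
    𝓢(EuclideanSpace ℝ ι, ℂ) →L[ℂ] 𝓢(EuclideanSpace ℝ ι, ℂ) :=
  ((|t ^ Module.finrank ℝ (EuclideanSpace ℝ ι)| : ℝ) : ℂ) •
    SchwartzMap.compCLMOfContinuousLinearEquiv ℂ
      (ContinuousLinearEquiv.smulLeft (R₁ := ℝ) (M₁ := EuclideanSpace ℝ ι) (Units.mk0 t ht))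

theorem rescale_apply (t : ℝ) (ht : t ≠ 0) (h : 𝓢(EuclideanSpace ℝ ι, ℂ))
    (y : EuclideanSpace ℝ ι) : rescale t ht h y =
      ((|t ^ Module.finrank ℝ (EuclideanSpace ℝ ι)| : ℝ) : ℂ) * h (t • y) := rfl

theorem mulCoord_rescale (t : ℝ) (ht : t ≠ 0) (v : EuclideanSpace ℝ ι)
    (h : 𝓢(EuclideanSpace ℝ ι, ℂ)) :
    mulCoord v (rescale t ht h) = ((t⁻¹ : ℝ) : ℂ) • rescale t ht (mulCoord v h) := by
  ext y
  rw [mulCoord_apply, smul_apply, rescale_apply, rescale_apply, mulCoord_apply, inner_smul_left,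
    smul_eq_mul]
  have : (t : ℂ) ≠ 0 := by exact_mod_cast ht
  push_cast
  field_simp
  simp

theorem mulPhase_rescale (B : EuclideanSpace ℝ ι ≃L[ℝ] EuclideanSpace ℝ ι) (t : ℝ) (ht : t ≠ 0)
    (v : EuclideanSpace ℝ ι) (h : 𝓢(EuclideanSpace ℝ ι, ℂ)) :
    mulPhase B v (rescale t ht h) = ((t⁻¹ : ℝ) : ℂ) • rescale t ht (mulPhase B v h) := by
  simp only [mulPhase, smul_apply, mulCoord_rescale, map_smul]
  rw [smul_comm]

theorem integral_rescale (t : ℝ) (ht : t ≠ 0) (h : 𝓢(EuclideanSpace ℝ ι, ℂ))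
    (F : EuclideanSpace ℝ ι → ℂ) :
    ∫ y, F y * rescale t ht h y = ∫ y, F (t⁻¹ • y) * h y := by
  have := Measure.integral_comp_smul (volume : Measure (EuclideanSpace ℝ ι))
    (fun y => F (t⁻¹ • y) * h y) t
  simp only [smul_smul, inv_mul_cancel₀ ht, one_smul] at this
  have h2 : ∀ y, F y * rescale t ht h y =
      ((|t ^ Module.finrank ℝ (EuclideanSpace ℝ ι)| : ℝ) : ℂ) * (F y * h (t • y)) := by
    intro y; rw [rescale_apply]; ring
  simp_rw [h2]
  rw [integral_const_mul, this, abs_inv, Complex.real_smul, ← mul_assoc, Complex.ofReal_inv,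
    mul_inv_cancel₀, one_mul]
  simp [ht]

variable (B : EuclideanSpace ℝ ι ≃L[ℝ] EuclideanSpace ℝ ι)

theorem pointwise_approx (hB : ∀ y, inner ℝ y (B y) = 0) (f : 𝓢(EuclideanSpace ℝ ι, ℂ))
    (x y : EuclideanSpace ℝ ι) :
    ‖f (x + y) * phase B y x - f x‖ ≤
      (2 * ‖(B : EuclideanSpace ℝ ι →L[ℝ] EuclideanSpace ℝ ι)‖ * SchwartzMap.seminorm ℝ 1 0 f +
        SchwartzMap.seminorm ℝ 0 1 f) * ‖y‖ := by
  have h1 : phase B y x = phase B y (x + y) := by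
    rw [phase, phase, map_add, inner_add_right, hB y, add_zero]
  have h2 : f (x + y) * phase B y x - f x =
      f (x + y) * (phase B y (x + y) - 1) + (f (x + y) - f x) := by rw [h1]; ring
  rw [h2, add_mul]
  refine (norm_add_le _ _).trans (add_le_add ?_ ?_)
  · have h3 : ‖phase B y (x + y) - 1‖ ≤ 2 * ‖inner ℝ y (B (x + y))‖ := by
      have := Real.norm_exp_I_mul_ofReal_sub_one_le (x := 2 * inner ℝ y (B (x + y)))
      rw [phase]
      convert this using 2
      · push_cast; ring_nf
      · simp
    have h4 : ‖inner ℝ y (B (x + y))‖ ≤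
        ‖y‖ * (‖(B : EuclideanSpace ℝ ι →L[ℝ] EuclideanSpace ℝ ι)‖ * ‖x + y‖) :=
      (norm_inner_le_norm _ _).trans (mul_le_mul_of_nonneg_left
        ((B : EuclideanSpace ℝ ι →L[ℝ] EuclideanSpace ℝ ι).le_opNorm _) (norm_nonneg _))
    have h5 := f.norm_pow_mul_le_seminorm ℝ 1 (x + y)
    rw [pow_one] at h5
    rw [norm_mul]
    calc ‖f (x + y)‖ * ‖phase B y (x + y) - 1‖
        ≤ ‖f (x + y)‖ * (2 * (‖y‖ *
          (‖(B : EuclideanSpace ℝ ι →L[ℝ] EuclideanSpace ℝ ι)‖ * ‖x + y‖))) := by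
          gcongr
          exact h3.trans (by gcongr)
      _ = 2 * ‖(B : EuclideanSpace ℝ ι →L[ℝ] EuclideanSpace ℝ ι)‖ * (‖x + y‖ * ‖f (x + y)‖) *
          ‖y‖ := by ring
      _ ≤ _ := by gcongr
  · have := Convex.norm_image_sub_le_of_norm_fderiv_le (𝕜 := ℝ) (f := f) (s := Set.univ)
      (C := SchwartzMap.seminorm ℝ 0 1 f) (x := x) (y := x + y)
      (fun z _ => f.differentiableAt) (fun z _ => by
        have := f.norm_iteratedFDeriv_le_seminorm ℝ 1 z
        rwa [norm_iteratedFDeriv_one] at this) convex_univ (Set.mem_univ _) (Set.mem_univ _)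
    simpa using this

/-- The approximation error. -/
def err (t : ℝ) (ht : t ≠ 0) (f h : 𝓢(EuclideanSpace ℝ ι, ℂ)) : 𝓢(EuclideanSpace ℝ ι, ℂ) :=
  twS B f (rescale t ht h) - (∫ y, h y) • f

theorem err_base (hB : ∀ y, inner ℝ y (B y) = 0) (f h : 𝓢(EuclideanSpace ℝ ι, ℂ)) :
    ∃ K : ℝ, ∀ t : ℝ, ∀ ht : t ≠ 0, SchwartzMap.seminorm ℂ 0 0 (err B t ht f h) ≤ |t⁻¹| * K := by
  let K1 := 2 * ‖(B : EuclideanSpace ℝ ι →L[ℝ] EuclideanSpace ℝ ι)‖ *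
    SchwartzMap.seminorm ℝ 1 0 f + SchwartzMap.seminorm ℝ 0 1 f
  have hK1 : 0 ≤ K1 := by positivity
  refine ⟨K1 * ∫ y, ‖y‖ ^ 1 * ‖h y‖, fun t ht => SchwartzMap.seminorm_le_bound ℂ _ _ _
    (by positivity) fun x => ?_⟩
  rw [norm_iteratedFDeriv_zero, pow_zero, one_mul]
  have hint : Integrable fun y => f (x + t⁻¹ • y) * phase B (t⁻¹ • y) x * h y := by
    refine Integrable.bdd_mul (c := SchwartzMap.seminorm ℝ 0 0 f) h.integrable
      (Continuous.aestronglyMeasurable (by fun_prop)) (ae_of_all _ fun y => ?_)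
    rw [norm_mul, norm_phase, mul_one]
    exact f.norm_le_seminorm ℝ _
  have h1 : err B t ht f h x =
      ∫ y, (f (x + t⁻¹ • y) * phase B (t⁻¹ • y) x - f x) * h y := by
    rw [err, sub_apply, smul_apply, twS_apply,
      integral_rescale t ht h (fun y => f (x + y) * phase B y x), smul_eq_mul,
      ← integral_mul_const, ← integral_sub hint (h.integrable.mul_const _)]
    congr 1; ext y; ring
  rw [h1, ← mul_assoc, ← integral_const_mul]
  refine norm_integral_le_of_norm_le ((h.integrable_pow_mul volume 1).const_mul _)
    (ae_of_all _ fun y => ?_)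
  rw [norm_mul]
  refine (mul_le_mul_of_nonneg_right (pointwise_approx B hB f x (t⁻¹ • y)) (norm_nonneg _)).trans
    (le_of_eq ?_)
  rw [norm_smul, Real.norm_eq_abs]
  ring

theorem mulCoord_err (v : EuclideanSpace ℝ ι) (t : ℝ) (ht : t ≠ 0)
    (f h : 𝓢(EuclideanSpace ℝ ι, ℂ)) :
    mulCoord v (err B t ht f h) = err B t ht (mulCoord v f) h -
      ((t⁻¹ : ℝ) : ℂ) • (err B t ht f (mulCoord v h) + (∫ y, mulCoord v h y) • f) := by
  simp only [err, map_sub, map_smul, mulCoord_twS, mulCoord_rescale, twS_smul_right,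
    sub_add_cancel]
  abel

theorem lineDeriv_err (v : EuclideanSpace ℝ ι) (t : ℝ) (ht : t ≠ 0)
    (f h : 𝓢(EuclideanSpace ℝ ι, ℂ)) :
    ∂_{v} (err B t ht f h) = err B t ht (∂_{v} f) h +
      ((t⁻¹ : ℝ) : ℂ) • (err B t ht f (mulPhase B v h) + (∫ y, mulPhase B v h y) • f) := by
  have h1 : ∀ g g' : 𝓢(EuclideanSpace ℝ ι, ℂ), ∀ c : ℂ,
      ∂_{v} (g - c • g') = ∂_{v} g - c • ∂_{v} g' := fun g g' c => by
    change LineDeriv.lineDerivOpCLM ℂ 𝓢(EuclideanSpace ℝ ι, ℂ) v (g - c • g') = _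
    rw [map_sub, map_smul]
    rfl
  simp only [err, h1, lineDeriv_twS, mulPhase_rescale, twS_smul_right, sub_add_cancel]
  abel

theorem tendsto_sum_zero {f : ι → ℕ → ℝ} (h : ∀ μ, Tendsto (f μ) atTop (𝓝 0)) :
    Tendsto (fun m => ∑ μ, f μ m) atTop (𝓝 0) := by
  simpa using tendsto_finsetSum Finset.univ fun μ _ => h μ

theorem tendsto_err (hB : ∀ y, inner ℝ y (B y) = 0) (k l : ℕ)
    (f h : 𝓢(EuclideanSpace ℝ ι, ℂ)) :
    Tendsto (fun m : ℕ => SchwartzMap.seminorm ℂ k l (err B (m + 1) (by positivity) f h)) atTop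
      (𝓝 0) := by
  have ht : Tendsto (fun m : ℕ => |((m : ℝ) + 1)⁻¹|) atTop (𝓝 0) := by
    have := (tendsto_one_div_add_atTop_nhds_zero_nat (𝕜 := ℝ)).abs
    simpa using this
  have step : ∀ (p : Seminorm ℂ 𝓢(EuclideanSpace ℝ ι, ℂ)),
      (∀ f h, Tendsto (fun m : ℕ => p (err B (m + 1) (by positivity) f h)) atTop (𝓝 0)) →
      ∀ f f' h h' (c : ℂ), Tendsto (fun m : ℕ => p (err B (m + 1) (by positivity) f' h) +
        |((m : ℝ) + 1)⁻¹| * (p (err B (m + 1) (by positivity) f h') + ‖c‖ * p f)) atTop (𝓝 0) := by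
    intro p hp f f' h h' c
    have := (hp f' h).add (ht.mul ((hp f h').add_const (‖c‖ * p f)))
    simpa using this
  have bd : ∀ (p : Seminorm ℂ 𝓢(EuclideanSpace ℝ ι, ℂ)) (r : ℝ) (c : ℂ) (w f : 𝓢(EuclideanSpace ℝ ι, ℂ)),
      p (((r : ℝ) : ℂ) • (w + c • f)) ≤ |r| * (p w + ‖c‖ * p f) := by
    intro p r c w f
    rw [map_smul_eq_mul, Complex.norm_real, Real.norm_eq_abs]
    refine mul_le_mul_of_nonneg_left ((map_add_le_add p _ _).trans ?_) (abs_nonneg _)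
    rw [map_smul_eq_mul]
  induction l generalizing f h with
  | zero =>
    induction k generalizing f h with
    | zero =>
      obtain ⟨K, hK⟩ := err_base B hB f h
      refine squeeze_zero (fun m => apply_nonneg _ _) (fun m => hK _ _) ?_
      simpa using ht.mul_const K
    | succ k ih =>
      refine squeeze_zero (fun m => apply_nonneg _ _) (fun m => seminorm_succ_left_le k _) ?_
      refine tendsto_sum_zero fun μ => ?_
      refine squeeze_zero (fun m => apply_nonneg _ _) (fun m => ?_)
        (step _ ih f (mulCoord (basisVec μ) f) h (mulCoord (basisVec μ) h)
          (∫ y, mulCoord (basisVec μ) h y))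
      rw [mulCoord_err]
      exact (map_sub_le_add _ _ _).trans (add_le_add_right (bd _ _ _ _ _) _)
  | succ l ih =>
    refine squeeze_zero (fun m => apply_nonneg _ _) (fun m => seminorm_succ_right_le k l _) ?_
    refine tendsto_sum_zero fun μ => ?_
    refine squeeze_zero (fun m => apply_nonneg _ _) (fun m => ?_)
      (step _ ih f (∂_{basisVec μ} f) h (mulPhase B (basisVec μ) h)
        (∫ y, mulPhase B (basisVec μ) h y))
    rw [lineDeriv_err]
    exact (map_add_le_add _ _ _).trans (add_le_add_right (bd _ _ _ _ _) _)

theorem tendsto_twS (hB : ∀ y, inner ℝ y (B y) = 0) (f h : 𝓢(EuclideanSpace ℝ ι, ℂ))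
    (hh : ∫ y, h y = 1) :
    Tendsto (fun m : ℕ => twS B f (rescale (m + 1) (by positivity) h)) atTop (𝓝 f) := by
  rw [(schwartz_withSeminorms ℂ (EuclideanSpace ℝ ι) ℂ).tendsto_nhds _ f]
  intro i ε hε
  have := (tendsto_err B hB i.1 i.2 f h).eventually (gt_mem_nhds hε)
  filter_upwards [this] with m hm
  change SchwartzMap.seminorm ℂ i.1 i.2 _ < ε
  rwa [err, hh, one_smul] at hm

theorem exists_integral_eq_one : ∃ h : 𝓢(EuclideanSpace ℝ ι, ℂ), ∫ y, h y = 1 := by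
  let φ : ContDiffBump (0 : EuclideanSpace ℝ ι) := default
  let g : EuclideanSpace ℝ ι → ℂ := fun x => ((φ.normed volume x : ℝ) : ℂ)
  have h1 : HasCompactSupport g := (φ.hasCompactSupport_normed).comp_left Complex.ofReal_zero
  have h2 : ContDiff ℝ ∞ g := Complex.ofRealCLM.contDiff.comp φ.contDiff_normed
  refine ⟨h1.toSchwartzMap h2, ?_⟩
  change ∫ y, ((φ.normed volume y : ℝ) : ℂ) = 1
  rw [integral_complex_ofReal, φ.integral_normed, Complex.ofReal_one]

end Approx

end

end Moyal

namespace Moyal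

noncomputable section

section Complete

variable {E : Type*} [NormedAddCommGroup E] [NormedSpace ℝ E]

instance : (uniformity 𝓢(E, ℂ)).IsCountablyGenerated :=
  IsUniformAddGroup.uniformity_countably_generated

theorem exists_tendsto_of_controlled (u : ℕ → 𝓢(E, ℂ))
    (hu : ∀ N m n, N ≤ m → N ≤ n → ∀ k ≤ N, ∀ l ≤ N,
      SchwartzMap.seminorm ℂ k l (u m - u n) ≤ (1 / 2 : ℝ) ^ N) :
    ∃ a, Tendsto u atTop (𝓝 a) := by
  let d : ℕ → 𝓢(E, ℂ) := fun i => u (i + 1) - u i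
  let v : ℕ → ℕ → ℕ → ℝ := fun k l i => SchwartzMap.seminorm ℂ k l (d i)
  have hv : ∀ k l, Summable (v k l) := by
    intro k l
    rw [← summable_nat_add_iff (max k l)]
    refine Summable.of_nonneg_of_le (fun i => apply_nonneg _ _) (fun i => ?_)
      ((summable_nat_add_iff (max k l)).2 (summable_geometric_two))
    exact hu _ _ _ (by omega) le_rfl _ (by omega) _ (by omega)
  have hsm : ∀ i, ContDiff ℝ ((⊤ : ℕ∞) : WithTop ℕ∞) (d i) := fun i => (d i).smooth ⊤
  have hb0 : ∀ (l i : ℕ) (x : E), ‖iteratedFDeriv ℝ l (d i) x‖ ≤ v 0 l i := by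
    intro l i x
    have := SchwartzMap.le_seminorm ℂ 0 l (d i) x
    simpa using this
  have hbk : ∀ (k l i : ℕ) (x : E), ‖x‖ ^ k * ‖iteratedFDeriv ℝ l (d i) x‖ ≤ v k l i :=
    fun k l i x => SchwartzMap.le_seminorm ℂ k l (d i) x
  have tail : ∀ (N k l : ℕ) (x : E),
      ‖x‖ ^ k * ‖iteratedFDeriv ℝ l (fun y => ∑' i, d (i + N) y) x‖ ≤ ∑' i, v k l (i + N) := by
    intro N k l x
    have h1 := iteratedFDeriv_tsum (f := fun i => ⇑(d (i + N))) (N := ⊤)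
      (v := fun l i => v 0 l (i + N)) (fun i => hsm _)
      (fun l _ => (summable_nat_add_iff N).2 (hv 0 l)) (fun l i x _ => hb0 _ _ _)
      (k := l) le_top
    rw [h1]
    have hsk : Summable fun i => v k l (i + N) := (summable_nat_add_iff N).2 (hv k l)
    have hsn : Summable fun i => ‖iteratedFDeriv ℝ l (d (i + N)) x‖ :=
      Summable.of_nonneg_of_le (fun i => norm_nonneg _) (fun i => hb0 _ _ _)
        ((summable_nat_add_iff N).2 (hv 0 l))
    refine (mul_le_mul_of_nonneg_left (norm_tsum_le_tsum_norm hsn) (by positivity)).trans ?_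
    rw [← tsum_mul_left]
    exact (hsn.mul_left _).tsum_le_tsum (fun i => hbk _ _ _ _) hsk
  have hsd : ∀ x, Summable fun i => d i x := fun x =>
    Summable.of_norm_bounded (hv 0 0) fun i => by
      have := hb0 0 i x
      rwa [norm_iteratedFDeriv_zero] at this
  let D : 𝓢(E, ℂ) :=
    { toFun := fun x => ∑' i, d i x
      smooth' := contDiff_tsum (N := ⊤) (v := fun l i => v 0 l i) (fun i => hsm _)
        (fun l _ => hv 0 l) (fun l i x _ => hb0 _ _ _)
      decay' := fun k l => ⟨_, fun x => tail 0 k l x⟩ }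
  refine ⟨u 0 + D, ?_⟩
  rw [(schwartz_withSeminorms ℂ E ℂ).tendsto_nhds _ _]
  intro i ε hε
  have ht := tendsto_sum_nat_add (v i.1 i.2)
  filter_upwards [ht.eventually (gt_mem_nhds hε)] with N hN
  refine lt_of_le_of_lt ?_ hN
  rw [map_sub_rev]
  refine SchwartzMap.seminorm_le_bound ℂ _ _ _ (tsum_nonneg fun i => apply_nonneg _ _) fun x => ?_
  have hfun : ⇑(u 0 + D - u N) = fun y => ∑' j, d (j + N) y := by
    ext y
    have h1 := (hsd y).sum_add_tsum_nat_add N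
    have h2 : ∑ j ∈ Finset.range N, d j y = u N y - u 0 y :=
      Finset.sum_range_sub (fun j => u j y) N
    have h3 : D y = ∑' j, d j y := rfl
    rw [sub_apply, add_apply, h3, ← h1, h2]
    ring
  rw [hfun]
  exact tail N _ _ x

instance : CompleteSpace 𝓢(E, ℂ) := by
  let U : ℕ → SetRel 𝓢(E, ℂ) 𝓢(E, ℂ) := fun N =>
    {p | ∀ k ≤ N, ∀ l ≤ N, SchwartzMap.seminorm ℂ k l (p.1 - p.2) < (1 / 2 : ℝ) ^ N}
  refine UniformSpace.complete_of_convergent_controlled_sequences U (fun N => ?_) fun u hu =>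
    exists_tendsto_of_controlled u fun N m n hm hn k hk l hl => (hu N m n hm hn k hk l hl).le
  have hc : ∀ k l, Continuous (SchwartzMap.seminorm ℂ k l : 𝓢(E, ℂ) → ℝ) := fun k l =>
    (schwartz_withSeminorms ℂ E ℂ).continuous_seminorm (k, l)
  have h0 : {a : 𝓢(E, ℂ) | ∀ k ≤ N, ∀ l ≤ N,
      SchwartzMap.seminorm ℂ k l a < (1 / 2 : ℝ) ^ N} ∈ 𝓝 (0 : 𝓢(E, ℂ)) := by
    have : ∀ᶠ a in 𝓝 (0 : 𝓢(E, ℂ)), ∀ k ∈ Finset.range (N + 1), ∀ l ∈ Finset.range (N + 1),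
        SchwartzMap.seminorm ℂ k l a < (1 / 2 : ℝ) ^ N := by
      rw [Filter.eventually_all_finset]
      intro k _
      rw [Filter.eventually_all_finset]
      intro l _
      have := (hc k l).tendsto 0
      rw [map_zero] at this
      exact this.eventually (gt_mem_nhds (by positivity))
    filter_upwards [this] with a ha k hk l hl
    exact ha k (Finset.mem_range.2 (by omega)) l (Finset.mem_range.2 (by omega))
  rw [uniformity_eq_comap_nhds_zero_swapped]
  exact ⟨_, h0, fun p hp => hp⟩

instance : BaireSpace 𝓢(E, ℂ) := by
  let _ := UniformSpace.pseudoMetricSpace 𝓢(E, ℂ)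
  infer_instance

instance : BarrelledSpace ℂ 𝓢(E, ℂ) := inferInstance

end Complete

end

end Moyal

namespace Moyal

noncomputable section

section Phase

variable {ι : Type*} [Fintype ι] (B : EuclideanSpace ℝ ι ≃L[ℝ] EuclideanSpace ℝ ι)

theorem inner_skew (hB : ∀ y, inner ℝ y (B y) = 0) (x y : EuclideanSpace ℝ ι) :
    inner ℝ x (B y) = - inner ℝ y (B x) := by
  have := hB (x + y)
  rw [map_add, inner_add_left, inner_add_right, inner_add_right, hB x, hB y] at this
  linarith

theorem phase_add_left (x y z : EuclideanSpace ℝ ι) :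
    phase B (x + y) z = phase B x z * phase B y z := by
  rw [phase, phase, phase, ← Complex.exp_add, inner_add_left]
  push_cast; ring_nf

theorem phase_add_right (x y z : EuclideanSpace ℝ ι) :
    phase B x (y + z) = phase B x y * phase B x z := by
  rw [phase, phase, phase, ← Complex.exp_add, map_add, inner_add_right]
  push_cast; ring_nf

theorem phase_neg_left (x y : EuclideanSpace ℝ ι) : phase B (-x) y = phase B x (-y) := by
  rw [phase, phase, map_neg, inner_neg_left, inner_neg_right]

theorem phase_swap (hB : ∀ y, inner ℝ y (B y) = 0) (x y : EuclideanSpace ℝ ι) :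
    phase B x (-y) = phase B y x := by
  rw [phase, phase, map_neg, inner_neg_right, inner_skew B hB x y, neg_neg]

theorem phase_self (hB : ∀ y, inner ℝ y (B y) = 0) (x : EuclideanSpace ℝ ι) :
    phase B x x = 1 := by
  rw [phase, hB]; simp

/-- The scaled operator `π⁻¹ B`. -/
def kmap : EuclideanSpace ℝ ι ≃L[ℝ] EuclideanSpace ℝ ι :=
  B.trans (ContinuousLinearEquiv.smulLeft (R₁ := ℝ) (M₁ := EuclideanSpace ℝ ι)
    (Units.mk0 Real.pi⁻¹ (inv_ne_zero Real.pi_ne_zero)))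

theorem kmap_apply (x : EuclideanSpace ℝ ι) : kmap B x = Real.pi⁻¹ • B x := rfl

/-- The normalisation constant `|det (π⁻¹ B)|`. -/
def normConst : ℝ :=
  |LinearMap.det ((kmap B : EuclideanSpace ℝ ι →L[ℝ] EuclideanSpace ℝ ι) :
    EuclideanSpace ℝ ι →ₗ[ℝ] EuclideanSpace ℝ ι)|

theorem kmap_det_ne_zero :
    LinearMap.det ((kmap B : EuclideanSpace ℝ ι →L[ℝ] EuclideanSpace ℝ ι) :
    EuclideanSpace ℝ ι →ₗ[ℝ] EuclideanSpace ℝ ι) ≠ 0 :=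
  (LinearEquiv.isUnit_det' (kmap B).toLinearEquiv).ne_zero

theorem normConst_pos : 0 < normConst B := abs_pos.2 (kmap_det_ne_zero B)

theorem integral_comp_kmap (f : EuclideanSpace ℝ ι → ℂ) :
    ∫ y, f (kmap B y) = ((normConst B)⁻¹ : ℝ) * ∫ y, f y := by
  have h1 := Measure.map_linearMap_addHaar_eq_smul_addHaar
    (volume : Measure (EuclideanSpace ℝ ι)) (kmap_det_ne_zero B)
  have h2 := integral_map_equiv (μ := (volume : Measure (EuclideanSpace ℝ ι)))
    (kmap B).toHomeomorph.toMeasurableEquiv f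
  have h3 : Measure.map ((kmap B).toHomeomorph.toMeasurableEquiv)
      (volume : Measure (EuclideanSpace ℝ ι)) =
      ENNReal.ofReal |(LinearMap.det ((kmap B : EuclideanSpace ℝ ι →L[ℝ] EuclideanSpace ℝ ι) :
        EuclideanSpace ℝ ι →ₗ[ℝ] EuclideanSpace ℝ ι))⁻¹| • volume := h1
  rw [h3, integral_smul_measure] at h2
  rw [ENNReal.toReal_ofReal (abs_nonneg _), abs_inv] at h2
  exact h2.symm

/-- The symplectic Fourier transform `y ↦ c ∫ exp (2 i ⟪w, B y⟫) b w dw`. -/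
def hat : 𝓢(EuclideanSpace ℝ ι, ℂ) →L[ℂ] 𝓢(EuclideanSpace ℝ ι, ℂ) :=
  ((normConst B : ℝ) : ℂ) • (SchwartzMap.compCLMOfContinuousLinearEquiv ℂ (kmap B) ∘L
    (FourierTransform.fourierCLE ℂ 𝓢(EuclideanSpace ℝ ι, ℂ)).symm.toContinuousLinearMap)

theorem hat_apply' (b : 𝓢(EuclideanSpace ℝ ι, ℂ)) (y : EuclideanSpace ℝ ι) :
    hat B b y = (normConst B : ℝ) * (𝓕⁻ b : 𝓢(EuclideanSpace ℝ ι, ℂ)) (kmap B y) := rfl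

theorem hat_apply (b : 𝓢(EuclideanSpace ℝ ι, ℂ)) (y : EuclideanSpace ℝ ι) :
    hat B b y = (normConst B : ℝ) * ∫ w, phase B w y * b w := by
  rw [hat_apply', fourierInv_coe, Real.fourierInv_eq']
  congr 2; ext w
  rw [smul_eq_mul, phase, kmap_apply, inner_smul_right]
  congr 2
  have := Real.pi_ne_zero
  have h : 2 * Real.pi * (Real.pi⁻¹ * inner ℝ w (B y)) = 2 * inner ℝ w (B y) := by field_simp
  rw [h]
  push_cast; ring

theorem exists_hat_eq (g : 𝓢(EuclideanSpace ℝ ι, ℂ)) : ∃ b, hat B b = g := by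
  have hc : ((normConst B : ℝ) : ℂ) ≠ 0 := by exact_mod_cast (normConst_pos B).ne'
  refine ⟨𝓕 (((normConst B : ℝ) : ℂ)⁻¹ •
    SchwartzMap.compCLMOfContinuousLinearEquiv ℂ (kmap B).symm g), ?_⟩
  ext y
  rw [hat_apply', FourierTransform.fourierInv_fourier_eq, smul_apply, smul_eq_mul,
    mul_inv_cancel_left₀ hc]
  change g ((kmap B).symm (kmap B y)) = g y
  rw [ContinuousLinearEquiv.symm_apply_apply]

theorem integrable_phase_mul (b : 𝓢(EuclideanSpace ℝ ι, ℂ)) (y : EuclideanSpace ℝ ι) :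
    Integrable fun w => phase B w y * b w :=
  b.integrable.bdd_mul (c := 1) (Continuous.aestronglyMeasurable (by fun_prop))
    (ae_of_all _ fun w => (norm_phase B w y).le)

theorem real_smulLeftCLM (m : EuclideanSpace ℝ ι) (b : 𝓢(EuclideanSpace ℝ ι, ℂ)) :
    smulLeftCLM ℂ (fun x => inner ℝ x m) b = mulCoord m b := by
  have : Function.HasTemperateGrowth (fun x : EuclideanSpace ℝ ι => inner ℝ x m) := by fun_prop
  ext x
  rw [mulCoord_apply, SchwartzMap.smulLeftCLM_apply_apply this, Complex.real_smul]

theorem hat_lineDeriv (hB : ∀ y, inner ℝ y (B y) = 0) (u : EuclideanSpace ℝ ι)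
    (b : 𝓢(EuclideanSpace ℝ ι, ℂ)) : hat B (∂_{u} b) = mulPhase B u (hat B b) := by
  ext y
  rw [mulPhase_apply, hat_apply', hat_apply', fourierInv_lineDerivOp_eq, real_smulLeftCLM,
    smul_apply, mulCoord_apply, kmap_apply, inner_smul_left, inner_skew B hB y u,
    real_inner_comm u (B y)]
  have : (Real.pi : ℂ) ≠ 0 := by exact_mod_cast Real.pi_ne_zero
  push_cast
  simp
  field_simp

theorem lineDeriv_hat (u : EuclideanSpace ℝ ι)
    (b : 𝓢(EuclideanSpace ℝ ι, ℂ)) : ∂_{u} (hat B b) = hat B (mulPhase B u b) := by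
  have h1 : hat B b = ((normConst B : ℝ) : ℂ) •
      SchwartzMap.compCLMOfContinuousLinearEquiv ℂ (kmap B) (𝓕⁻ b) := rfl
  have h2 : ∂_{u} (hat B b) = ((normConst B : ℝ) : ℂ) •
      ∂_{u} (SchwartzMap.compCLMOfContinuousLinearEquiv ℂ (kmap B) (𝓕⁻ b)) := by
    rw [h1]
    exact map_smul (LineDeriv.lineDerivOpCLM ℂ 𝓢(EuclideanSpace ℝ ι, ℂ) u) _ _
  have h3 : mulPhase B u b = (2 * Real.pi * Complex.I) • mulCoord (kmap B u) b := by
    ext y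
    have : (Real.pi : ℂ) ≠ 0 := by exact_mod_cast Real.pi_ne_zero
    rw [mulPhase_apply, smul_apply, mulCoord_apply, kmap_apply, inner_smul_right, smul_eq_mul]
    push_cast
    field_simp
  rw [h2, lineDerivOp_compCLMOfContinuousLinearEquiv, lineDerivOp_fourierInv_eq,
    real_smulLeftCLM, h3]
  rfl

end Phase

section Star

variable {ι : Type*} [Fintype ι] (B : EuclideanSpace ℝ ι ≃L[ℝ] EuclideanSpace ℝ ι)

theorem integrable_shear {f g : EuclideanSpace ℝ ι → ℂ} (hf : Integrable f) (hg : Integrable g) :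
    Integrable (fun p : EuclideanSpace ℝ ι × EuclideanSpace ℝ ι => f (p.1 + p.2) * g p.2)
      (volume.prod volume) := by
  have h := (measurePreserving_add_prod (volume : Measure (EuclideanSpace ℝ ι))
    (volume : Measure (EuclideanSpace ℝ ι))).integrable_comp_of_integrable (hf.mul_prod hg)
  exact h

theorem integrable_shear_sub {f g : EuclideanSpace ℝ ι → ℂ} (hf : Integrable f)
    (hg : Integrable g) :
    Integrable (fun p : EuclideanSpace ℝ ι × EuclideanSpace ℝ ι => f (p.1 - p.2) * g p.2)
      (volume.prod volume) := by
  have h := (measurePreserving_sub_prod (volume : Measure (EuclideanSpace ℝ ι))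
    (volume : Measure (EuclideanSpace ℝ ι))).integrable_comp_of_integrable (hf.mul_prod hg)
  exact h

theorem hat_twS (hB : ∀ y, inner ℝ y (B y) = 0) (b k : 𝓢(EuclideanSpace ℝ ι, ℂ))
    (y : EuclideanSpace ℝ ι) :
    hat B (twS B b k) y = ∫ z, phase B y z * hat B b (y - z) * k z := by
  simp_rw [hat_apply, twS_apply, ← integral_const_mul]
  rw [integral_integral_swap]
  · congr 1; ext z
    have h : ∀ w, ((normConst B : ℝ) : ℂ) * (phase B w y * (b (w + z) * phase B z w * k z)) =
        (fun w => (normConst B : ℝ) * (phase B (w - z) y * (b w * phase B z (w - z) * k z)))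
          (w + z) := by
      intro w; simp
    rw [integral_congr_ae (ae_of_all _ h)]
    rw [integral_add_right_eq_self (fun w => ((normConst B : ℝ) : ℂ) *
      (phase B (w - z) y * (b w * phase B z (w - z) * k z))) z]
    rw [← integral_mul_const]
    congr 1; ext w
    rw [sub_eq_add_neg w z, phase_add_left, phase_add_right, phase_neg_left, phase_swap B hB z y,
      phase_swap B hB z z, phase_self B hB, sub_eq_add_neg y z, phase_add_right,
      phase_swap B hB w z]
    ring
  · have h := (integrable_shear b.integrable k.integrable).bdd_mul (c := normConst B)
      (f := fun p : EuclideanSpace ℝ ι × EuclideanSpace ℝ ι =>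
        ((normConst B : ℝ) : ℂ) * (phase B p.1 y * phase B p.2 p.1))
      (Continuous.aestronglyMeasurable (by fun_prop)) (ae_of_all _ fun p => by
        rw [norm_mul, norm_mul, norm_phase, norm_phase, mul_one, mul_one, Complex.norm_real,
          Real.norm_eq_abs, abs_of_pos (normConst_pos B)])
    refine h.congr (ae_of_all _ fun p => ?_)
    simp only [Function.uncurry]
    ring

theorem twS_assoc (hB : ∀ y, inner ℝ y (B y) = 0) (a b k : 𝓢(EuclideanSpace ℝ ι, ℂ)) :
    twS B (twS B a (hat B b)) k = twS B a (hat B (twS B b k)) := by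
  ext x
  have h1 : twS B (twS B a (hat B b)) k x = ∫ z, ∫ y,
      a (x + y) * phase B y x * (phase B y z * hat B b (y - z) * k z) := by
    rw [twS_apply]
    congr 1; ext z
    rw [twS_apply, ← integral_mul_const, ← integral_mul_const,
      ← integral_sub_right_eq_self _ z]
    congr 1; ext y
    rw [show x + z + (y - z) = x + y by abel, sub_eq_add_neg y z, phase_add_left,
      phase_add_right, phase_neg_left, phase_swap B hB, phase_add_left, phase_self B hB]
    have h2 : phase B x z * phase B z x = 1 := by
      rw [← phase_swap B hB x z, ← phase_add_right, add_neg_cancel]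
      simp [phase]
    linear_combination (a (x + y) * phase B y x * phase B y z * (hat B b) (y + -z) * k z) * h2
  rw [h1, twS_apply, integral_integral_swap]
  · congr 1; ext y
    rw [hat_twS B hB, ← integral_const_mul]
  · have h := ((integrable_shear_sub (hat B b).integrable k.integrable).bdd_mul
      (c := SchwartzMap.seminorm ℝ 0 0 a)
      (f := fun p : EuclideanSpace ℝ ι × EuclideanSpace ℝ ι =>
        a (x + p.1) * (phase B p.1 x * phase B p.1 p.2))
      (Continuous.aestronglyMeasurable (by fun_prop)) (ae_of_all _ fun p => by
        rw [norm_mul, norm_mul, norm_phase, norm_phase, mul_one, mul_one]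
        exact a.norm_le_seminorm ℝ _)).swap
    refine h.congr (ae_of_all _ fun p => ?_)
    simp only [Function.uncurry, Function.comp, Prod.fst_swap, Prod.snd_swap]
    ring

theorem integral_twS_hat (hB : ∀ y, inner ℝ y (B y) = 0) (a b : 𝓢(EuclideanSpace ℝ ι, ℂ)) :
    ∫ x, twS B a (hat B b) x = ∫ x, a x * b x := by
  have hc : ((normConst B : ℝ) : ℂ) ≠ 0 := by exact_mod_cast (normConst_pos B).ne'
  simp_rw [twS_apply]
  rw [integral_integral_swap]
  · have h1 : ∀ y, ∫ x, a (x + y) * phase B y x * hat B b y =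
        (((normConst B : ℝ) : ℂ)⁻¹ * hat B a (-y)) * hat B b y := by
      intro y
      rw [integral_mul_const, hat_apply B a (-y), inv_mul_cancel_left₀ hc]
      congr 1
      rw [← integral_add_right_eq_self (fun w => phase B w (-y) * a w) y]
      congr 1; ext x
      rw [phase_swap B hB, phase_add_right, phase_self B hB]
      ring
    simp_rw [h1, hat_apply']
    have h2 : ∀ y, (𝓕⁻ a : 𝓢(EuclideanSpace ℝ ι, ℂ)) (kmap B (-y)) =
        (𝓕 a : 𝓢(EuclideanSpace ℝ ι, ℂ)) (kmap B y) := by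
      intro y
      rw [fourierInv_apply_eq, map_neg]
      change (𝓕 a : 𝓢(EuclideanSpace ℝ ι, ℂ)) (- - kmap B y) = _
      rw [neg_neg]
    have h3 := integral_comp_kmap B fun y => (normConst B : ℂ) *
      ((𝓕 a : 𝓢(EuclideanSpace ℝ ι, ℂ)) y * (𝓕⁻ b : 𝓢(EuclideanSpace ℝ ι, ℂ)) y)
    rw [integral_const_mul, integral_const_mul, integral_fourier_mul_eq, Complex.ofReal_inv, inv_mul_cancel_left₀ hc,
      FourierTransform.fourier_fourierInv_eq] at h3
    rw [← h3, ← integral_const_mul]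
    congr 1; ext y
    rw [h2]
    field_simp
  · have h := (integrable_shear a.integrable (hat B b).integrable).bdd_mul (c := 1)
      (f := fun p : EuclideanSpace ℝ ι × EuclideanSpace ℝ ι => phase B p.2 p.1)
      (Continuous.aestronglyMeasurable (by fun_prop)) (ae_of_all _ fun p => by rw [norm_phase])
    refine h.congr (ae_of_all _ fun p => ?_)
    simp only [Function.uncurry]
    ring

theorem twS_lineDeriv_right (hB : ∀ y, inner ℝ y (B y) = 0) (u : EuclideanSpace ℝ ι)
    (a h : 𝓢(EuclideanSpace ℝ ι, ℂ)) :
    mulPhase B u (twS B a h) = twS B a (∂_{u} h) + twS B (∂_{u} a) h := by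
  ext x
  rw [mulPhase_apply, add_apply, twS_apply, twS_apply, twS_apply]
  have hd : ∀ y, HasFDerivAt (fun y => a (x + y) * phase B y x)
      (a (x + y) • ((-(2 * Complex.I) * phase B y x) • (Complex.ofRealCLM ∘L (innerSL ℝ x) ∘L
        (B : EuclideanSpace ℝ ι →L[ℝ] EuclideanSpace ℝ ι))) +
        phase B y x • fderiv ℝ a (x + y)) y := by
    intro y
    have h1 : HasFDerivAt (fun y => a (x + y)) (fderiv ℝ a (x + y)) y :=
      (hasFDerivAt_comp_add_left x).2 (a.hasFDerivAt (x + y))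
    have h2 : HasFDerivAt (fun y => phase B y x) ((-(2 * Complex.I) * phase B y x) •
        (Complex.ofRealCLM ∘L (innerSL ℝ x) ∘L
        (B : EuclideanSpace ℝ ι →L[ℝ] EuclideanSpace ℝ ι))) y := by
      have h3 := (hasFDerivAt_phase B (-x) y).congr_fderiv (f' := (2 * Complex.I *
        phase B (-x) y) • (Complex.ofRealCLM ∘L (innerSL ℝ (-x)) ∘L
        (B : EuclideanSpace ℝ ι →L[ℝ] EuclideanSpace ℝ ι))) (g' := (-(2 * Complex.I) *
        phase B y x) • (Complex.ofRealCLM ∘L (innerSL ℝ x) ∘L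
        (B : EuclideanSpace ℝ ι →L[ℝ] EuclideanSpace ℝ ι))) (by
          rw [phase_neg_left, phase_swap B hB]
          ext v
          simp)
      have h4 : (fun y => phase B (-x) y) = fun y => phase B y x := by
        ext y; rw [phase_neg_left, phase_swap B hB]
      rwa [h4] at h3
    exact h1.mul h2
  have hfd : ∀ y, fderiv ℝ (fun y => a (x + y) * phase B y x) y u =
      (∂_{u} a) (x + y) * phase B y x -
        2 * Complex.I * ((inner ℝ x (B u) : ℝ) : ℂ) * (a (x + y) * phase B y x) := by
    intro y
    rw [(hd y).fderiv]
    simp [SchwartzMap.lineDerivOp_apply_eq_fderiv]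
    ring
  have hi1 := integrable_tw B (∂_{u} a) h x
  have hi2 := (integrable_tw B a h x).const_mul (2 * Complex.I * ((inner ℝ x (B u) : ℝ) : ℂ))
  have key := integral_mul_fderiv_eq_neg_fderiv_mul_of_integrable (𝕜 := ℂ) (μ := volume) (v := u)
    (f := fun y => a (x + y) * phase B y x) (g := h)
    (by
      refine (hi1.sub hi2).congr (ae_of_all _ fun y => ?_)
      simp only [hfd, Pi.sub_apply]
      ring)
    (integrable_tw B a (∂_{u} h) x)
    (integrable_tw B a h x)
    (fun y _ => (hd y).differentiableAt) (fun y _ => h.differentiableAt)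
  have e1 : ∀ y, a (x + y) * phase B y x * (∂_{u} h) y =
      a (x + y) * phase B y x * fderiv ℝ h y u := fun y => by
    rw [SchwartzMap.lineDerivOp_apply_eq_fderiv]
  simp_rw [e1]
  rw [key, ← integral_const_mul, ← integral_neg, ← integral_add]
  · congr 1; ext y
    rw [hfd]; ring
  · refine (hi2.sub hi1).congr (ae_of_all _ fun y => ?_)
    simp only [hfd, Pi.sub_apply]
    ring
  · exact hi1

end Star

end

end Moyal

namespace Moyal

noncomputable section

/-- The index set of the `2 n` coordinates: `(i, k)` is the `i`-th coordinate of the `k`-th plane. -/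
abbrev Idx (n : ℕ) := Fin 2 × Fin n

/-- The Euclidean space of dimension `2 n`. -/
abbrev PhaseSpace (n : ℕ) := EuclideanSpace ℝ (Idx n)

/-- The Schwartz space in dimension `2 n`. -/
abbrev TestFn (n : ℕ) := 𝓢(PhaseSpace n, ℂ)

/-- The noncommutativity matrix `Θ = θ diag (J, …, J)` with `J = !![0, -1; 1, 0]`. -/
def Theta (n : ℕ) (θ : ℝ) : Matrix (Idx n) (Idx n) ℝ :=
  θ • Matrix.blockDiagonal fun _ : Fin n => !![0, -1; 1, 0]

/-- The inverse matrix `Θ⁻¹`. -/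
def ThetaInv (n : ℕ) (θ : ℝ) : Matrix (Idx n) (Idx n) ℝ := (Theta n θ)⁻¹

section Theta

variable (n : ℕ) (θ : ℝ)

theorem det_Theta : (Theta n θ).det = θ ^ (2 * n) := by
  rw [Theta, Matrix.det_smul, Matrix.det_blockDiagonal]
  simp [Matrix.det_fin_two]

theorem transpose_Theta : (Theta n θ).transpose = - Theta n θ := by
  rw [Theta, Matrix.transpose_smul, Matrix.blockDiagonal_transpose, ← smul_neg,
    ← Matrix.blockDiagonal_neg]
  congr 2
  ext k i j
  fin_cases i <;> fin_cases j <;> simp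

variable [NeZero θ]

theorem isUnit_det_Theta : IsUnit (Theta n θ).det := by
  rw [det_Theta]
  exact (pow_ne_zero _ (NeZero.ne θ)).isUnit

theorem transpose_ThetaInv : (ThetaInv n θ).transpose = - ThetaInv n θ := by
  rw [ThetaInv, Matrix.transpose_nonsing_inv, transpose_Theta]
  refine Matrix.inv_eq_right_inv ?_
  rw [neg_mul_neg, Matrix.mul_nonsing_inv _ (isUnit_det_Theta n θ)]

/-- The linear automorphism of phase space with matrix `Θ⁻¹`. -/
def thetaInvEquiv : PhaseSpace n ≃L[ℝ] PhaseSpace n :=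
  ContinuousLinearEquiv.equivOfInverse
    (Matrix.toEuclideanCLM (𝕜 := ℝ) (ThetaInv n θ)) (Matrix.toEuclideanCLM (𝕜 := ℝ) (Theta n θ))
    (fun x => by
      rw [← mul_apply_eq_comp, ← map_mul, ThetaInv,
        Matrix.mul_nonsing_inv _ (isUnit_det_Theta n θ), map_one]; rfl)
    (fun x => by
      rw [← mul_apply_eq_comp, ← map_mul, ThetaInv,
        Matrix.nonsing_inv_mul _ (isUnit_det_Theta n θ), map_one]; rfl)

theorem inner_thetaInvEquiv (y z : PhaseSpace n) :
    inner ℝ y (thetaInvEquiv n θ z) = y.ofLp ⬝ᵥ (ThetaInv n θ).mulVec z.ofLp := by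
  rw [EuclideanSpace.inner_eq_star_dotProduct, dotProduct_comm]
  rfl

theorem thetaInvEquiv_skew (y : PhaseSpace n) : inner ℝ y (thetaInvEquiv n θ y) = 0 := by
  have h : y.ofLp ⬝ᵥ (ThetaInv n θ).mulVec y.ofLp = - (y.ofLp ⬝ᵥ (ThetaInv n θ).mulVec y.ofLp) := by
    conv_lhs => rw [Matrix.dotProduct_mulVec, ← Matrix.mulVec_transpose, transpose_ThetaInv,
      Matrix.neg_mulVec, neg_dotProduct, dotProduct_comm]
  rw [inner_thetaInvEquiv]
  linarith

theorem normConst_thetaInvEquiv :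
    normConst (thetaInvEquiv n θ) = 1 / (Real.pi * θ) ^ (2 * n) := by
  have h1 : ((kmap (thetaInvEquiv n θ) : PhaseSpace n →L[ℝ] PhaseSpace n) :
      PhaseSpace n →ₗ[ℝ] PhaseSpace n) = Real.pi⁻¹ • Matrix.toEuclideanLin (ThetaInv n θ) := rfl
  have h2 : LinearMap.det (Matrix.toEuclideanLin (ThetaInv n θ)) = (ThetaInv n θ).det := by
    rw [Matrix.toEuclideanLin_eq_toLin_orthonormal, LinearMap.det_toLin]
  rw [normConst, h1, LinearMap.det_smul, h2, ThetaInv, Matrix.det_nonsing_inv, det_Theta,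
    finrank_euclideanSpace, Fintype.card_prod, Fintype.card_fin, Fintype.card_fin,
    Ring.inverse_eq_inv', ← inv_pow, ← mul_pow, ← mul_inv, inv_pow, abs_of_nonneg, one_div]
  exact inv_nonneg.2 (Even.pow_nonneg (even_two_mul n) _)

theorem star_integral (a b : TestFn n) (x : PhaseSpace n) :
    ((1 / (Real.pi * θ) ^ (2 * n) : ℝ) : ℂ) * ∫ y : PhaseSpace n, ∫ z : PhaseSpace n,
      a (x + y) * b (x + z) *
        Complex.exp (-2 * Complex.I * ((y.ofLp ⬝ᵥ (ThetaInv n θ).mulVec z.ofLp : ℝ) : ℂ)) =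
    twS (thetaInvEquiv n θ) a (hat (thetaInvEquiv n θ) b) x := by
  have hB := thetaInvEquiv_skew n θ
  rw [twS_apply, ← normConst_thetaInvEquiv, ← integral_const_mul]
  congr 1; ext y
  rw [hat_apply, ← integral_sub_left_eq_self (fun w => phase (thetaInvEquiv n θ) w y * b w)
    volume x]
  rw [← integral_neg_eq_self]
  have h : ∀ z : PhaseSpace n, a (x + y) * b (x + -z) * Complex.exp (-2 * Complex.I *
      ((y.ofLp ⬝ᵥ (ThetaInv n θ).mulVec (-z).ofLp : ℝ) : ℂ)) =
      a (x + y) * phase (thetaInvEquiv n θ) y x *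
        (phase (thetaInvEquiv n θ) (x - z) y * b (x - z)) := by
    intro z
    have h1 : Complex.exp (-2 * Complex.I *
      ((y.ofLp ⬝ᵥ (ThetaInv n θ).mulVec (-z).ofLp : ℝ) : ℂ)) = phase (thetaInvEquiv n θ) y z := by
      rw [← inner_thetaInvEquiv, map_neg, inner_neg_right, phase]
      push_cast; ring_nf
    have h2 : phase (thetaInvEquiv n θ) y x * phase (thetaInvEquiv n θ) x y = 1 := by
      rw [← phase_swap _ hB y x, ← phase_add_right, add_neg_cancel]
      simp [phase]
    rw [h1, sub_eq_add_neg x z, phase_add_left, phase_neg_left, phase_swap _ hB]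
    linear_combination -(a (x + y) * phase (thetaInvEquiv n θ) y z * b (x + -z)) * h2
  simp_rw [h]
  rw [integral_const_mul]
  ring

/-- The Moyal product of Schwartz functions,
`(a ⋆ b)(x) = (π θ)⁻²ⁿ ∫∫ a (x + y) b (x + z) exp (-2 i y Θ⁻¹ z) dy dz`. -/
def starProd (a b : TestFn n) : TestFn n where
  toFun x := ((1 / (Real.pi * θ) ^ (2 * n) : ℝ) : ℂ) * ∫ y : PhaseSpace n, ∫ z : PhaseSpace n,
    a (x + y) * b (x + z) *
      Complex.exp (-2 * Complex.I * ((y.ofLp ⬝ᵥ (ThetaInv n θ).mulVec z.ofLp : ℝ) : ℂ))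
  smooth' := by
    simp_rw [star_integral]
    exact (twS (thetaInvEquiv n θ) a (hat (thetaInvEquiv n θ) b)).smooth'
  decay' := by
    simp_rw [star_integral]
    exact (twS (thetaInvEquiv n θ) a (hat (thetaInvEquiv n θ) b)).decay'

theorem starProd_eq (a b : TestFn n) :
    starProd n θ a b = twS (thetaInvEquiv n θ) a (hat (thetaInvEquiv n θ) b) := by
  ext x
  exact star_integral n θ a b x

end Theta

end

end Moyal

namespace Moyal

noncomputable section

section StarAlg

variable (n : ℕ) (θ : ℝ) [NeZero θ]

theorem starProd_assoc (a b c : TestFn n) :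
    starProd n θ (starProd n θ a b) c = starProd n θ a (starProd n θ b c) := by
  simp only [starProd_eq]
  exact twS_assoc _ (thetaInvEquiv_skew n θ) a b _

/-- The Moyal product as a bilinear map. -/
def starLM : TestFn n →ₗ[ℂ] TestFn n →ₗ[ℂ] TestFn n :=
  LinearMap.mk₂ ℂ (starProd n θ)
    (fun a b c => by simp only [starProd_eq, twS_add_left])
    (fun c a b => by simp only [starProd_eq, twS_smul_left])
    (fun a b c => by simp only [starProd_eq, map_add, twS_add_right])
    (fun c a b => by simp only [starProd_eq, map_smul, twS_smul_right])

/-- Left multiplication by a Schwartz function. -/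
def starLeft (a : TestFn n) : TestFn n →L[ℂ] TestFn n where
  toLinearMap := starLM n θ a
  cont := by
    have : ⇑(starLM n θ a) = fun b => twS (thetaInvEquiv n θ) a (hat (thetaInvEquiv n θ) b) := by
      ext1 b; exact starProd_eq n θ a b
    change Continuous (starLM n θ a)
    rw [this]
    exact (continuous_twS_right _ a).comp (hat (thetaInvEquiv n θ)).continuous

/-- Right multiplication by a Schwartz function. -/
def starRight (b : TestFn n) : TestFn n →L[ℂ] TestFn n where
  toLinearMap := (starLM n θ).flip b
  cont := by
    have : ⇑((starLM n θ).flip b) =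
        fun a => twS (thetaInvEquiv n θ) a (hat (thetaInvEquiv n θ) b) := by
      ext1 a; exact starProd_eq n θ a b
    change Continuous ((starLM n θ).flip b)
    rw [this]
    exact continuous_twS_left _ _

theorem starLeft_apply (a b : TestFn n) : starLeft n θ a b = starProd n θ a b := rfl

theorem starRight_apply (a b : TestFn n) : starRight n θ b a = starProd n θ a b := rfl

/-- The pairing `∫ f g`. -/
def pair (f g : TestFn n) : ℂ := ∫ x, f x * g x

theorem pair_comm (f g : TestFn n) : pair n f g = pair n g f := by
  simp only [pair, mul_comm]

theorem integrable_mul (f g : TestFn n) : Integrable fun x => f x * g x :=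
  g.integrable.bdd_mul (c := SchwartzMap.seminorm ℝ 0 0 f) f.continuous.aestronglyMeasurable
    (ae_of_all _ fun x => f.norm_le_seminorm ℝ x)

theorem pair_add_right (f g h : TestFn n) : pair n f (g + h) = pair n f g + pair n f h := by
  simp only [pair]
  rw [← integral_add (integrable_mul n f g) (integrable_mul n f h)]
  simp only [add_apply, mul_add]

theorem pair_smul_right (c : ℂ) (f g : TestFn n) : pair n f (c • g) = c * pair n f g := by
  simp only [pair]
  rw [← integral_const_mul]
  congr 1; ext x
  rw [smul_apply, smul_eq_mul]; ring

theorem pair_add_left (f g h : TestFn n) : pair n (f + g) h = pair n f h + pair n g h := by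
  rw [pair_comm, pair_add_right, pair_comm, pair_comm n h]

theorem pair_smul_left (c : ℂ) (f g : TestFn n) : pair n (c • f) g = c * pair n f g := by
  rw [pair_comm, pair_smul_right, pair_comm]

theorem pair_sub_left (f g h : TestFn n) : pair n (f - g) h = pair n f h - pair n g h := by
  have : f - g = f + (-1 : ℂ) • g := by rw [neg_one_smul, sub_eq_add_neg]
  rw [this, pair_add_left, pair_smul_left]; ring

theorem pair_sub_right (f g h : TestFn n) : pair n f (g - h) = pair n f g - pair n f h := by
  rw [pair_comm, pair_sub_left, pair_comm, pair_comm n h]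

theorem coe_apply_eq_pair (g f : TestFn n) : (g : 𝓢'(PhaseSpace n, ℂ)) f = pair n f g := by
  exact SchwartzMap.toTemperedDistributionCLM_apply_apply volume g f

theorem pair_ext {g h : TestFn n} (H : ∀ f, pair n f g = pair n f h) : g = h := by
  have h1 : (g : 𝓢'(PhaseSpace n, ℂ)) = h := by
    ext f
    rw [coe_apply_eq_pair, coe_apply_eq_pair, H]
  have h2 : (MeasureTheory.Lp.toTemperedDistributionCLM ℂ (volume : Measure (PhaseSpace n)) 2)
      (g.toLp 2) = (MeasureTheory.Lp.toTemperedDistributionCLM ℂ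
      (volume : Measure (PhaseSpace n)) 2) (h.toLp 2) := by
    rw [MeasureTheory.Lp.toTemperedDistributionCLM_apply,
      MeasureTheory.Lp.toTemperedDistributionCLM_apply,
      MeasureTheory.Lp.toTemperedDistribution_toLp_eq,
      MeasureTheory.Lp.toTemperedDistribution_toLp_eq, h1]
  exact SchwartzMap.injective_toLp 2 _ (LinearMap.ker_eq_bot.1
    (MeasureTheory.Lp.ker_toTemperedDistributionCLM_eq_bot (F := ℂ)
      (μ := (volume : Measure (PhaseSpace n))) (p := 2)) h2)

theorem integral_starProd (a b : TestFn n) : ∫ x, starProd n θ a b x = pair n a b := by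
  rw [starProd_eq]
  exact integral_twS_hat _ (thetaInvEquiv_skew n θ) a b

theorem pair_starProd (f g h : TestFn n) :
    pair n (starProd n θ f g) h = pair n f (starProd n θ g h) := by
  rw [← integral_starProd n θ, ← integral_starProd n θ, starProd_assoc]

/-- An approximate unit for the Moyal product. -/
theorem exists_approx_unit : ∃ e : ℕ → TestFn n,
    ∀ f, Tendsto (fun m => starProd n θ f (e m)) atTop (𝓝 f) := by
  obtain ⟨h, hh⟩ := exists_integral_eq_one (ι := Idx n)
  choose e he using fun m : ℕ => exists_hat_eq (thetaInvEquiv n θ)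
    (rescale ((m : ℝ) + 1) (by positivity) h)
  refine ⟨e, fun f => ?_⟩
  simp only [starProd_eq, he]
  exact tendsto_twS _ (thetaInvEquiv_skew n θ) f h hh

theorem lineDeriv_starProd (u : PhaseSpace n) (a b : TestFn n) :
    ∂_{u} (starProd n θ a b) = starProd n θ (∂_{u} a) b + starProd n θ a (∂_{u} b) := by
  simp only [starProd_eq]
  rw [lineDeriv_twS, hat_lineDeriv _ (thetaInvEquiv_skew n θ)]

theorem two_I_ne_zero : (2 * Complex.I : ℂ) ≠ 0 := by simp

theorem mulCoord_starProd (u : PhaseSpace n) (a b : TestFn n) :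
    mulCoord (thetaInvEquiv n θ u) (starProd n θ a b) =
      starProd n θ (mulCoord (thetaInvEquiv n θ u) a) b +
        (Complex.I / 2) • starProd n θ a (∂_{u} b) := by
  simp only [starProd_eq]
  rw [mulCoord_twS, hat_lineDeriv _ (thetaInvEquiv_skew n θ), mulPhase, smul_apply,
    twS_smul_right, smul_smul]
  have : Complex.I / 2 * (2 * Complex.I) = -1 := by
    linear_combination Complex.I_mul_I
  rw [this, neg_one_smul, sub_eq_add_neg]

theorem mulCoord_starProd' (u : PhaseSpace n) (a b : TestFn n) :
    mulCoord (thetaInvEquiv n θ u) (starProd n θ a b) =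
      starProd n θ a (mulCoord (thetaInvEquiv n θ u) b) -
        (Complex.I / 2) • starProd n θ (∂_{u} a) b := by
  simp only [starProd_eq]
  have h := twS_lineDeriv_right (thetaInvEquiv n θ) (thetaInvEquiv_skew n θ) u a
    (hat (thetaInvEquiv n θ) b)
  rw [lineDeriv_hat] at h
  simp only [mulPhase, smul_apply, map_smul, twS_smul_right] at h
  have h2 := congrArg (fun g => (2 * Complex.I)⁻¹ • g) h
  simp only [smul_add, smul_smul, inv_mul_cancel₀ two_I_ne_zero, one_smul] at h2
  have h3 : (2 * Complex.I)⁻¹ = -(Complex.I / 2) := by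
    rw [mul_inv, Complex.inv_I]; ring
  rw [h2, h3, neg_smul, sub_eq_add_neg]

theorem pair_mulCoord (v : PhaseSpace n) (f g : TestFn n) :
    pair n (mulCoord v f) g = pair n f (mulCoord v g) := by
  simp only [pair, mulCoord_apply]
  congr 1; ext x; ring

theorem pair_lineDeriv (v : PhaseSpace n) (f g : TestFn n) :
    pair n (∂_{v} f) g = - pair n f (∂_{v} g) := by
  have := integral_mul_lineDerivOp_right_eq_neg_left (μ := volume) f g v
  simp only [pair]
  rw [this, neg_neg]

end StarAlg

end

end Moyal

namespace Moyal

noncomputable section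

section Algebra

variable (n : ℕ) (θ : ℝ) [NeZero θ]

/-- The tempered distribution `T ⋆ a`, given by `⟨T ⋆ a, f⟩ = ⟨T, a ⋆ f⟩`. -/
def distStar (T : 𝓢'(PhaseSpace n, ℂ)) (a : TestFn n) : 𝓢'(PhaseSpace n, ℂ) :=
  PointwiseConvergenceCLM.precomp ℂ (starLeft n θ a) T

/-- The tempered distribution `a ⋆ T`, given by `⟨a ⋆ T, f⟩ = ⟨T, f ⋆ a⟩`. -/
def starDist (a : TestFn n) (T : 𝓢'(PhaseSpace n, ℂ)) : 𝓢'(PhaseSpace n, ℂ) :=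
  PointwiseConvergenceCLM.precomp ℂ (starRight n θ a) T

theorem distStar_apply (T : 𝓢'(PhaseSpace n, ℂ)) (a f : TestFn n) :
    distStar n θ T a f = T (starProd n θ a f) := rfl

theorem starDist_apply (T : 𝓢'(PhaseSpace n, ℂ)) (a f : TestFn n) :
    starDist n θ a T f = T (starProd n θ f a) := rfl

/-- The left multipliers: tempered distributions `T` with `a ⋆ T` Schwartz for all Schwartz `a`. -/
def leftMultipliers : Submodule ℂ 𝓢'(PhaseSpace n, ℂ) where
  carrier := {T | ∀ a : TestFn n, ∃ g : TestFn n, (g : 𝓢'(PhaseSpace n, ℂ)) = starDist n θ a T}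
  add_mem' {S T} hS hT a := by
    obtain ⟨g, hg⟩ := hS a
    obtain ⟨h, hh⟩ := hT a
    exact ⟨g + h, by rw [map_add, hg, hh]; exact (map_add (PointwiseConvergenceCLM.precomp ℂ
      (starRight n θ a)) S T).symm⟩
  zero_mem' a := ⟨0, by rw [map_zero]; exact (map_zero (PointwiseConvergenceCLM.precomp ℂ
      (starRight n θ a))).symm⟩
  smul_mem' c T hT a := by
    obtain ⟨g, hg⟩ := hT a
    exact ⟨c • g, by rw [map_smul, hg]; exact (map_smul (PointwiseConvergenceCLM.precomp ℂ
      (starRight n θ a)) c T).symm⟩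

/-- The right multipliers: tempered distributions `T` with `T ⋆ a` Schwartz for all Schwartz `a`. -/
def rightMultipliers : Submodule ℂ 𝓢'(PhaseSpace n, ℂ) where
  carrier := {T | ∀ a : TestFn n, ∃ g : TestFn n, (g : 𝓢'(PhaseSpace n, ℂ)) = distStar n θ T a}
  add_mem' {S T} hS hT a := by
    obtain ⟨g, hg⟩ := hS a
    obtain ⟨h, hh⟩ := hT a
    exact ⟨g + h, by rw [map_add, hg, hh]; exact (map_add (PointwiseConvergenceCLM.precomp ℂ
      (starLeft n θ a)) S T).symm⟩
  zero_mem' a := ⟨0, by rw [map_zero]; exact (map_zero (PointwiseConvergenceCLM.precomp ℂ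
      (starLeft n θ a))).symm⟩
  smul_mem' c T hT a := by
    obtain ⟨g, hg⟩ := hT a
    exact ⟨c • g, by rw [map_smul, hg]; exact (map_smul (PointwiseConvergenceCLM.precomp ℂ
      (starLeft n θ a)) c T).symm⟩

/-- The Moyal algebra: the tempered distributions that are left and right multipliers. -/
def MoyalAlgebra : Type :=
  ↥(leftMultipliers n θ ⊓ rightMultipliers n θ : Submodule ℂ 𝓢'(PhaseSpace n, ℂ))

instance : AddCommGroup (MoyalAlgebra n θ) :=
  inferInstanceAs (AddCommGroup
    ↥(leftMultipliers n θ ⊓ rightMultipliers n θ : Submodule ℂ 𝓢'(PhaseSpace n, ℂ)))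

instance : Module ℂ (MoyalAlgebra n θ) :=
  inferInstanceAs (Module ℂ
    ↥(leftMultipliers n θ ⊓ rightMultipliers n θ : Submodule ℂ 𝓢'(PhaseSpace n, ℂ)))

variable {n θ}

/-- The tempered distribution underlying an element of the Moyal algebra. -/
def toDist : MoyalAlgebra n θ →ₗ[ℂ] 𝓢'(PhaseSpace n, ℂ) :=
  (leftMultipliers n θ ⊓ rightMultipliers n θ : Submodule ℂ 𝓢'(PhaseSpace n, ℂ)).subtype

theorem moyal_ext {S T : MoyalAlgebra n θ} (h : ∀ f, toDist S f = toDist T f) : S = T :=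
  Subtype.ext (DFunLike.ext _ _ h)

theorem toDist_add_apply (S T : MoyalAlgebra n θ) (f : TestFn n) :
    toDist (S + T) f = toDist S f + toDist T f := rfl

theorem toDist_smul_apply (c : ℂ) (T : MoyalAlgebra n θ) (f : TestFn n) :
    toDist (c • T) f = c * toDist T f := rfl

/-- `a ⋆ T` as a Schwartz function. -/
def lact (T : MoyalAlgebra n θ) (a : TestFn n) : TestFn n := (T.2.1 a).choose

/-- `T ⋆ a` as a Schwartz function. -/
def ract (T : MoyalAlgebra n θ) (a : TestFn n) : TestFn n := (T.2.2 a).choose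

theorem pair_lact (T : MoyalAlgebra n θ) (a f : TestFn n) :
    pair n f (lact T a) = toDist T (starProd n θ f a) := by
  rw [← coe_apply_eq_pair]
  exact congrArg (fun S : 𝓢'(PhaseSpace n, ℂ) => S f) (T.2.1 a).choose_spec

theorem pair_ract (T : MoyalAlgebra n θ) (a f : TestFn n) :
    pair n f (ract T a) = toDist T (starProd n θ a f) := by
  rw [← coe_apply_eq_pair]
  exact congrArg (fun S : 𝓢'(PhaseSpace n, ℂ) => S f) (T.2.2 a).choose_spec

/-- Build an element of the Moyal algebra. -/
def mkMoyal (T : 𝓢'(PhaseSpace n, ℂ)) (l r : TestFn n → TestFn n)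
    (hl : ∀ a f, T (starProd n θ f a) = pair n f (l a))
    (hr : ∀ a f, T (starProd n θ a f) = pair n f (r a)) : MoyalAlgebra n θ :=
  ⟨T, fun a => ⟨l a, by ext f; rw [coe_apply_eq_pair]; exact (hl a f).symm⟩,
    fun a => ⟨r a, by ext f; rw [coe_apply_eq_pair]; exact (hr a f).symm⟩⟩

theorem toDist_mkMoyal (T : 𝓢'(PhaseSpace n, ℂ)) (l r : TestFn n → TestFn n)
    (hl : ∀ a f, T (starProd n θ f a) = pair n f (l a))
    (hr : ∀ a f, T (starProd n θ a f) = pair n f (r a)) :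
    toDist (mkMoyal (θ := θ) T l r hl hr) = T := rfl

theorem ract_mkMoyal (T : 𝓢'(PhaseSpace n, ℂ)) (l r : TestFn n → TestFn n)
    (hl : ∀ a f, T (starProd n θ f a) = pair n f (l a))
    (hr : ∀ a f, T (starProd n θ a f) = pair n f (r a)) (a : TestFn n) :
    ract (mkMoyal (θ := θ) T l r hl hr) a = r a :=
  pair_ext n fun f => by rw [pair_ract, toDist_mkMoyal, hr]

theorem ract_starProd (T : MoyalAlgebra n θ) (a b : TestFn n) :
    ract T (starProd n θ a b) = starProd n θ (ract T a) b :=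
  pair_ext n fun f => by
    rw [pair_ract, starProd_assoc, ← pair_ract, pair_comm n f, pair_starProd n θ (ract T a), pair_comm]

theorem lact_starProd (T : MoyalAlgebra n θ) (a b : TestFn n) :
    lact T (starProd n θ a b) = starProd n θ a (lact T b) :=
  pair_ext n fun f => by
    rw [pair_lact, ← starProd_assoc, ← pair_lact, pair_starProd]

theorem ract_add_left (S T : MoyalAlgebra n θ) (a : TestFn n) :
    ract (S + T) a = ract S a + ract T a :=
  pair_ext n fun f => by
    rw [pair_ract, pair_add_right, pair_ract, pair_ract, toDist_add_apply]

theorem ract_smul_left (c : ℂ) (T : MoyalAlgebra n θ) (a : TestFn n) :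
    ract (c • T) a = c • ract T a :=
  pair_ext n fun f => by
    rw [pair_ract, pair_smul_right, pair_ract, toDist_smul_apply]

theorem ract_add (T : MoyalAlgebra n θ) (a b : TestFn n) :
    ract T (a + b) = ract T a + ract T b :=
  pair_ext n fun f => by
    rw [pair_ract, pair_add_right, pair_ract, pair_ract, ← map_add]
    congr 1
    exact map_add ((starLM n θ).flip f) a b

theorem ract_smul (T : MoyalAlgebra n θ) (c : ℂ) (a : TestFn n) :
    ract T (c • a) = c • ract T a :=
  pair_ext n fun f => by
    rw [pair_ract, pair_smul_right, pair_ract, ← smul_eq_mul, ← map_smul]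
    congr 1
    exact map_smul ((starLM n θ).flip f) c a

theorem integral_ract (T : MoyalAlgebra n θ) (a : TestFn n) :
    ∫ x, ract T a x = toDist T a := by
  obtain ⟨e, he⟩ := exists_approx_unit n θ
  have h1 : Tendsto (fun m => toDist T (starProd n θ a (e m))) atTop (𝓝 (toDist T a)) :=
    ((toDist T).continuous.tendsto a).comp (he a)
  have h2 : Tendsto (fun m => SchwartzMap.integralCLM ℂ (volume : Measure (PhaseSpace n))
      (starProd n θ (ract T a) (e m))) atTop (𝓝 (SchwartzMap.integralCLM ℂ
        (volume : Measure (PhaseSpace n)) (ract T a))) :=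
    ((SchwartzMap.integralCLM ℂ _).continuous.tendsto _).comp (he _)
  simp only [SchwartzMap.integralCLM_apply, integral_starProd] at h2
  refine tendsto_nhds_unique h2 (h1.congr fun m => ?_)
  rw [← pair_ract, pair_comm]

/-- The functional `a ↦ ⟨S, T ⋆ a⟩`, continuous by the Banach–Steinhaus theorem. -/
theorem continuous_toDist_ract (S T : MoyalAlgebra n θ) :
    Continuous fun a => toDist S (ract T a) := by
  obtain ⟨e, he⟩ := exists_approx_unit n θ
  let g : ℕ → TestFn n →L[ℂ] ℂ := fun m =>
    { toFun := fun a => toDist T (starProd n θ a (lact S (e m)))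
      map_add' := fun a b => by
        rw [← map_add]; congr 1
        exact map_add ((starLM n θ).flip (lact S (e m))) a b
      map_smul' := fun c a => by
        rw [RingHom.id_apply, ← map_smul]; congr 1
        exact map_smul ((starLM n θ).flip (lact S (e m))) c a
      cont := (toDist T).continuous.comp (starRight n θ (lact S (e m))).continuous }
  have h : Tendsto (fun m a => g m a) atTop (𝓝 fun a => toDist S (ract T a)) := by
    rw [tendsto_pi_nhds]
    intro a
    have h1 := ((toDist S).continuous.tendsto (ract T a)).comp (he (ract T a))
    refine h1.congr fun m => ?_
    change toDist S (starProd n θ (ract T a) (e m)) = toDist T (starProd n θ a (lact S (e m)))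
    rw [← pair_lact, ← pair_ract, pair_comm]
  exact (continuousLinearMapOfTendsto g h).continuous

/-- The functional `a ↦ ⟨S, T ⋆ a⟩` as a tempered distribution. -/
def mulDist (S T : MoyalAlgebra n θ) : 𝓢'(PhaseSpace n, ℂ) :=
  ContinuousLinearMap.toPointwiseConvergenceCLM _ _ _ _
    { toFun := fun a => toDist S (ract T a)
      map_add' := fun a b => by rw [ract_add, map_add]
      map_smul' := fun c a => by rw [ract_smul, map_smul, RingHom.id_apply]
      cont := continuous_toDist_ract S T }

theorem mulDist_apply (S T : MoyalAlgebra n θ) (a : TestFn n) :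
    mulDist S T a = toDist S (ract T a) := rfl

/-- The Moyal product on the Moyal algebra, `⟨S ⋆ T, a⟩ = ⟨S, T ⋆ a⟩`. -/
instance : Mul (MoyalAlgebra n θ) where
  mul S T := mkMoyal (mulDist S T) (fun a => lact T (lact S a)) (fun a => ract S (ract T a))
    (fun a f => by
      rw [mulDist_apply, ract_starProd, ← pair_lact, pair_comm, pair_ract, ← pair_lact])
    (fun a f => by rw [mulDist_apply, ract_starProd, pair_ract])

/-- The unit of the Moyal algebra is the constant function `1`, i.e. Lebesgue measure. -/
instance : One (MoyalAlgebra n θ) where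
  one := mkMoyal (volume : Measure (PhaseSpace n)).toTemperedDistribution id id
    (fun a f => by
      exact integral_starProd n θ f a)
    (fun a f => by
      exact (integral_starProd n θ a f).trans (pair_comm n a f))

theorem toDist_mul_apply (S T : MoyalAlgebra n θ) (a : TestFn n) :
    toDist (S * T) a = toDist S (ract T a) := rfl

theorem ract_mul (S T : MoyalAlgebra n θ) (a : TestFn n) :
    ract (S * T) a = ract S (ract T a) := ract_mkMoyal _ _ _ _ _ a

theorem toDist_one_apply (a : TestFn n) :
    toDist (1 : MoyalAlgebra n θ) a = ∫ x, a x := rfl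

theorem ract_one (a : TestFn n) : ract (1 : MoyalAlgebra n θ) a = a := ract_mkMoyal _ _ _ _ _ a

instance : Ring (MoyalAlgebra n θ) where
  __ := (inferInstance : AddCommGroup (MoyalAlgebra n θ))
  mul_assoc R S T := moyal_ext fun f => by
    simp only [toDist_mul_apply, ract_mul]
  one_mul T := moyal_ext fun f => by
    rw [toDist_mul_apply, toDist_one_apply, integral_ract]
  mul_one T := moyal_ext fun f => by
    rw [toDist_mul_apply, ract_one]
  left_distrib R S T := moyal_ext fun f => by
    rw [toDist_mul_apply, ract_add_left, map_add]
    rfl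
  right_distrib R S T := moyal_ext fun f => by
    rfl
  zero_mul T := moyal_ext fun f => rfl
  mul_zero T := moyal_ext fun f => by
    have h : ract (0 : MoyalAlgebra n θ) f = 0 := by
      have := ract_smul_left (0 : ℂ) (0 : MoyalAlgebra n θ) f
      rwa [zero_smul, zero_smul] at this
    rw [toDist_mul_apply, h, map_zero]
    rfl

instance : Algebra ℂ (MoyalAlgebra n θ) :=
  Algebra.ofModule
    (fun c S T => moyal_ext fun f => rfl)
    (fun c S T => moyal_ext fun f => by
      rw [toDist_mul_apply, ract_smul_left, map_smul]
      rfl)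

end Algebra

end

end Moyal

namespace Moyal

noncomputable section

section Coord

variable {n : ℕ} {θ : ℝ} [NeZero θ]

/-- Commutative multiplication of an element of the Moyal algebra by `x ↦ ⟪x, Θ⁻¹ u⟫`. -/
def coordMul (u : PhaseSpace n) (T : MoyalAlgebra n θ) : MoyalAlgebra n θ :=
  mkMoyal (PointwiseConvergenceCLM.precomp ℂ (mulCoord (thetaInvEquiv n θ u)) (toDist T))
    (fun a => lact T (mulCoord (thetaInvEquiv n θ u) a) + (Complex.I / 2) • ∂_{u} (lact T a))
    (fun a => ract T (mulCoord (thetaInvEquiv n θ u) a) - (Complex.I / 2) • ∂_{u} (ract T a))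
    (fun a f => by
      change toDist T (mulCoord (thetaInvEquiv n θ u) (starProd n θ f a)) = _
      rw [mulCoord_starProd', map_sub, map_smul, ← pair_lact, ← pair_lact, pair_lineDeriv,
        pair_add_right, pair_smul_right, smul_eq_mul]
      ring)
    (fun a f => by
      change toDist T (mulCoord (thetaInvEquiv n θ u) (starProd n θ a f)) = _
      rw [mulCoord_starProd, map_add, map_smul, ← pair_ract, ← pair_ract, pair_lineDeriv,
        pair_sub_right, pair_smul_right, smul_eq_mul]
      ring)

theorem toDist_coordMul (u : PhaseSpace n) (T : MoyalAlgebra n θ) (f : TestFn n) :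
    toDist (coordMul u T) f = toDist T (mulCoord (thetaInvEquiv n θ u) f) := rfl

theorem ract_coordMul (u : PhaseSpace n) (T : MoyalAlgebra n θ) (a : TestFn n) :
    ract (coordMul u T) a =
      ract T (mulCoord (thetaInvEquiv n θ u) a) - (Complex.I / 2) • ∂_{u} (ract T a) :=
  ract_mkMoyal _ _ _ _ _ a

theorem integral_lineDeriv (u : PhaseSpace n) (f : TestFn n) : ∫ x, (∂_{u} f) x = 0 := by
  have h := integral_mul_fderiv_eq_neg_fderiv_mul_of_integrable (𝕜 := ℂ)
    (μ := (volume : Measure (PhaseSpace n))) (v := u) (f := fun _ => (1 : ℂ)) (g := f)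
    (by simp) (by
      simp only [one_mul]
      exact (∂_{u} f : TestFn n).integrable) (by simpa using f.integrable)
    (fun _ _ => by fun_prop) (fun x _ => f.differentiableAt)
  simp only [one_mul, fderiv_fun_const, Pi.zero_apply, zero_apply, zero_mul, integral_zero,
    neg_zero] at h
  exact h

theorem mul_coord_one (u : PhaseSpace n) (T : MoyalAlgebra n θ) (f : TestFn n) :
    toDist (T * coordMul u 1) f =
      toDist T (mulCoord (thetaInvEquiv n θ u) f) - Complex.I / 2 * toDist T (∂_{u} f) := by
  rw [toDist_mul_apply, ract_coordMul, ract_one, ract_one, map_sub, map_smul, smul_eq_mul]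

theorem coord_one_mul (u : PhaseSpace n) (T : MoyalAlgebra n θ) (f : TestFn n) :
    toDist (coordMul u 1 * T) f =
      toDist T (mulCoord (thetaInvEquiv n θ u) f) + Complex.I / 2 * toDist T (∂_{u} f) := by
  have h : ract T (mulCoord (thetaInvEquiv n θ u) f + (Complex.I / 2) • ∂_{u} f) =
      mulCoord (thetaInvEquiv n θ u) (ract T f) + (Complex.I / 2) • ∂_{u} (ract T f) := by
    refine pair_ext n fun g => ?_
    have h1 : starProd n θ (mulCoord (thetaInvEquiv n θ u) f + (Complex.I / 2) • ∂_{u} f) g =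
        starProd n θ f (mulCoord (thetaInvEquiv n θ u) g - (Complex.I / 2) • ∂_{u} g) := by
      have e1 := mulCoord_starProd n θ u f g
      have e2 := mulCoord_starProd' n θ u f g
      have e3 := map_add ((starLM n θ).flip g) (mulCoord (thetaInvEquiv n θ u) f)
        ((Complex.I / 2) • ∂_{u} f)
      have e4 := map_sub (starLM n θ f) (mulCoord (thetaInvEquiv n θ u) g)
        ((Complex.I / 2) • ∂_{u} g)
      rw [map_smul] at e3 e4
      change starProd n θ _ g = starProd n θ _ g + (Complex.I / 2) • starProd n θ _ g at e3
      change starProd n θ f _ = starProd n θ f _ - (Complex.I / 2) • starProd n θ f _ at e4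
      rw [e3, e4, eq_sub_iff_add_eq.2 e1.symm, eq_add_of_sub_eq e2.symm]
      abel
    rw [pair_ract, h1, ← pair_ract, pair_sub_left, pair_smul_left, pair_mulCoord, pair_lineDeriv,
      pair_add_right, pair_smul_right]
    ring
  have h2 := integral_ract T (mulCoord (thetaInvEquiv n θ u) f + (Complex.I / 2) • ∂_{u} f)
  rw [map_add, map_smul, h] at h2
  rw [toDist_mul_apply, toDist_coordMul, toDist_one_apply, ← smul_eq_mul, ← h2]
  rw [← toDist_one_apply (θ := θ), ← toDist_one_apply (θ := θ), map_add, map_smul,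
    toDist_one_apply (∂_{u} (ract T f)), integral_lineDeriv, smul_zero, add_zero]

theorem coordMul_eq (u : PhaseSpace n) (T : MoyalAlgebra n θ) :
    coordMul u T = (1 / 2 : ℂ) • (coordMul u 1 * T + T * coordMul u 1) := moyal_ext fun f => by
  rw [toDist_smul_apply, toDist_add_apply, mul_coord_one, coord_one_mul, toDist_coordMul]
  ring

end Coord

section Poly

variable {n : ℕ}

/-- The polynomial function on phase space defined by a complex polynomial. -/
def polyFun (p : MvPolynomial (Idx n) ℂ) (x : PhaseSpace n) : ℂ :=
  MvPolynomial.eval (fun μ => (x μ : ℂ)) p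

theorem hasTemperateGrowth_coord (μ : Idx n) :
    Function.HasTemperateGrowth (fun x : PhaseSpace n => (x μ : ℂ)) := by
  have h : Function.HasTemperateGrowth (fun x : PhaseSpace n =>
    ((inner ℝ x (basisVec μ) : ℝ) : ℂ)) := by fun_prop
  have e : (fun x : PhaseSpace n => ((inner ℝ x (basisVec μ) : ℝ) : ℂ)) =
      fun x : PhaseSpace n => (x μ : ℂ) := by
    ext x
    simp [basisVec, EuclideanSpace.inner_single_right]
  rwa [e] at h

theorem hasTemperateGrowth_polyFun (p : MvPolynomial (Idx n) ℂ) :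
    Function.HasTemperateGrowth (polyFun p) := by
  induction p using MvPolynomial.induction_on with
  | C c =>
    have : polyFun (MvPolynomial.C c : MvPolynomial (Idx n) ℂ) = fun _ => c := by
      ext x; simp [polyFun]
    rw [this]
    exact Function.HasTemperateGrowth.const c
  | add p q hp hq =>
    have : polyFun (p + q) = polyFun p + polyFun q := by
      ext x; simp [polyFun]
    rw [this]
    exact hp.add hq
  | mul_X p μ hp =>
    have : polyFun (p * MvPolynomial.X μ) = polyFun p * fun x : PhaseSpace n => (x μ : ℂ) := by
      ext x; simp [polyFun]
    rw [this]
    exact hp.mul (hasTemperateGrowth_coord μ)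

/-- The tempered distribution `f ↦ ∫ p f` defined by a polynomial function `p`. -/
def polyDist (p : MvPolynomial (Idx n) ℂ) : 𝓢'(PhaseSpace n, ℂ) :=
  (hasTemperateGrowth_polyFun p).toTemperedDistribution volume

theorem polyDist_apply (p : MvPolynomial (Idx n) ℂ) (f : TestFn n) :
    polyDist p f = ∫ x, f x * polyFun p x := rfl

theorem integrable_polyFun_mul (p : MvPolynomial (Idx n) ℂ) (f : TestFn n) :
    Integrable fun x => f x * polyFun p x := by
  have h := (SchwartzMap.smulLeftCLM ℂ (polyFun p) f).integrable (μ := volume)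
  refine h.congr (ae_of_all _ fun x => ?_)
  rw [SchwartzMap.smulLeftCLM_apply_apply (hasTemperateGrowth_polyFun p), smul_eq_mul]
  ring

theorem polyDist_add (p q : MvPolynomial (Idx n) ℂ) : polyDist (p + q) = polyDist p + polyDist q := by
  ext f
  change polyDist (p + q) f = polyDist p f + polyDist q f
  rw [polyDist_apply, polyDist_apply, polyDist_apply,
    ← integral_add (integrable_polyFun_mul p f) (integrable_polyFun_mul q f)]
  congr 1; ext x
  simp only [polyFun, map_add]; ring

theorem polyDist_smul (c : ℂ) (p : MvPolynomial (Idx n) ℂ) : polyDist (c • p) = c • polyDist p := by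
  ext f
  change polyDist (c • p) f = c * polyDist p f
  rw [polyDist_apply, polyDist_apply, ← integral_const_mul]
  congr 1; ext x
  simp only [polyFun, MvPolynomial.smul_eval]; ring

theorem polyDist_mul_X (p : MvPolynomial (Idx n) ℂ) (μ : Idx n) (f : TestFn n) :
    polyDist (p * MvPolynomial.X μ) f = polyDist p (mulCoord (basisVec μ) f) := by
  rw [polyDist_apply, polyDist_apply]
  congr 1; ext x
  have : ((inner ℝ x (basisVec μ) : ℝ) : ℂ) = (x μ : ℂ) := by
    simp [basisVec, EuclideanSpace.inner_single_right]
  rw [mulCoord_apply, this]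
  simp only [polyFun, map_mul, MvPolynomial.eval_X]; ring

theorem polyDist_C (c : ℂ) (f : TestFn n) :
    polyDist (MvPolynomial.C c) f = c * ∫ x, f x := by
  rw [polyDist_apply, ← integral_const_mul]
  congr 1; ext x
  simp only [polyFun, MvPolynomial.eval_C]; ring

variable {θ : ℝ} [NeZero θ]

theorem exists_toDist_eq_polyDist (p : MvPolynomial (Idx n) ℂ) :
    ∃ T : MoyalAlgebra n θ, toDist T = polyDist p := by
  induction p using MvPolynomial.induction_on with
  | C c =>
    refine ⟨c • 1, ?_⟩
    ext f
    rw [toDist_smul_apply, toDist_one_apply, polyDist_C]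
  | add p q hp hq =>
    obtain ⟨S, hS⟩ := hp
    obtain ⟨T, hT⟩ := hq
    exact ⟨S + T, by rw [map_add, hS, hT, polyDist_add]⟩
  | mul_X p μ hp =>
    obtain ⟨T, hT⟩ := hp
    refine ⟨coordMul ((thetaInvEquiv n θ).symm (basisVec μ)) T, ?_⟩
    ext f
    rw [toDist_coordMul, ContinuousLinearEquiv.apply_symm_apply, hT, polyDist_mul_X]

/-- A multiplier as an element of the Moyal algebra. -/
def ofDist (T : 𝓢'(PhaseSpace n, ℂ)) (hT : T ∈ leftMultipliers n θ ⊓ rightMultipliers n θ) :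
    MoyalAlgebra n θ := ⟨T, hT⟩

theorem toDist_ofDist (T : 𝓢'(PhaseSpace n, ℂ))
    (hT : T ∈ leftMultipliers n θ ⊓ rightMultipliers n θ) : toDist (ofDist T hT) = T := rfl

theorem toDist_mem (T : MoyalAlgebra n θ) :
    toDist T ∈ leftMultipliers n θ ⊓ rightMultipliers n θ := T.2

variable (n θ)

theorem polyDist_mem (p : MvPolynomial (Idx n) ℂ) :
    polyDist p ∈ leftMultipliers n θ ⊓ rightMultipliers n θ := by
  obtain ⟨T, hT⟩ := exists_toDist_eq_polyDist (θ := θ) p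
  rw [← hT]
  exact toDist_mem T

/-- The inclusion of the polynomial functions into the Moyal algebra. -/
def polyElem : MvPolynomial (Idx n) ℂ →ₗ[ℂ] MoyalAlgebra n θ where
  toFun p := ofDist (polyDist p) (polyDist_mem n θ p)
  map_add' p q := moyal_ext fun f => by
    rw [toDist_add_apply, toDist_ofDist, toDist_ofDist, toDist_ofDist, polyDist_add]
    rfl
  map_smul' c p := moyal_ext fun f => by
    rw [RingHom.id_apply, toDist_smul_apply, toDist_ofDist, toDist_ofDist, polyDist_smul]
    rfl

variable {n θ}

theorem toDist_polyElem (p : MvPolynomial (Idx n) ℂ) : toDist (polyElem n θ p) = polyDist p := rfl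

theorem polyElem_one : polyElem n θ 1 = 1 := moyal_ext fun f => by
  rw [toDist_polyElem, ← MvPolynomial.C_1, polyDist_C, one_mul, toDist_one_apply]

theorem polyElem_C (c : ℂ) : polyElem n θ (MvPolynomial.C c) = c • 1 := by
  rw [← polyElem_one, ← map_smul, MvPolynomial.smul_eq_C_mul, mul_one]

theorem polyElem_mul_X (p : MvPolynomial (Idx n) ℂ) (μ : Idx n) :
    polyElem n θ (p * MvPolynomial.X μ) =
      coordMul ((thetaInvEquiv n θ).symm (basisVec μ)) (polyElem n θ p) := moyal_ext fun f => by
  rw [toDist_coordMul, ContinuousLinearEquiv.apply_symm_apply, toDist_polyElem, toDist_polyElem,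
    polyDist_mul_X]

theorem polyElem_X (μ : Idx n) : polyElem n θ (MvPolynomial.X μ) =
    coordMul ((thetaInvEquiv n θ).symm (basisVec μ)) 1 := by
  rw [← one_mul (MvPolynomial.X μ), polyElem_mul_X, polyElem_one]

theorem polyElem_mul_X' (p : MvPolynomial (Idx n) ℂ) (μ : Idx n) :
    polyElem n θ (p * MvPolynomial.X μ) = (1 / 2 : ℂ) •
      (polyElem n θ (MvPolynomial.X μ) * polyElem n θ p +
        polyElem n θ p * polyElem n θ (MvPolynomial.X μ)) := by
  rw [polyElem_mul_X, coordMul_eq, polyElem_X]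

theorem polyElem_injective : Function.Injective (polyElem n θ) := by
  rw [← LinearMap.ker_eq_bot, LinearMap.ker_eq_bot']
  intro p hp
  have hd : ∀ f, polyDist p f = 0 := fun f => by
    rw [← toDist_polyElem (θ := θ), hp]; rfl
  have hc : Continuous (polyFun p) := (hasTemperateGrowth_polyFun p).1.continuous
  have h0 : polyFun p =ᵐ[volume] 0 := by
    refine ae_eq_zero_of_integral_contDiff_smul_eq_zero hc.locallyIntegrable ?_
    intro g g_smooth g_cpt
    have hg₁ : HasCompactSupport (Complex.ofRealCLM ∘ g) := g_cpt.comp_left rfl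
    have hg₂ : ContDiff ℝ ∞ (Complex.ofRealCLM ∘ g) := by fun_prop
    exact hd (hg₁.toSchwartzMap hg₂)
  have h1 : polyFun p = 0 := (hc.ae_eq_iff_eq volume continuous_zero).1 h0
  refine MvPolynomial.funext_set (fun _ => Set.range ((↑) : ℝ → ℂ))
    (fun _ => Set.infinite_range_of_injective Complex.ofReal_injective) ?_
  intro x hx
  choose y hy using fun μ => hx μ (Set.mem_univ μ)
  have := congrFun h1 (WithLp.toLp 2 y)
  simp only [polyFun, hy] at this
  rw [this, map_zero]
  rfl

theorem lineDeriv_mulCoord (u v : PhaseSpace n) (f : TestFn n) :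
    ∂_{u} (mulCoord v f) = mulCoord v (∂_{u} f) + ((inner ℝ u v : ℝ) : ℂ) • f := by
  ext x
  have h1 : ⇑(mulCoord v f) = fun x => ((inner ℝ x v : ℝ) : ℂ) * f x := by
    ext x; exact mulCoord_apply v f x
  have h2 : HasFDerivAt (fun x => ((inner ℝ x v : ℝ) : ℂ))
      (Complex.ofRealCLM ∘L (innerSL ℝ v)) x := by
    have e : (fun x : PhaseSpace n => ((inner ℝ x v : ℝ) : ℂ)) =
        (Complex.ofRealCLM ∘L (innerSL ℝ v)) := by
      ext x; simp [real_inner_comm]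
    rw [e]
    exact ContinuousLinearMap.hasFDerivAt _
  have h3 : HasFDerivAt (fun x => ((inner ℝ x v : ℝ) : ℂ) * f x) _ x :=
    h2.mul (f.hasFDerivAt x)
  rw [SchwartzMap.lineDerivOp_apply_eq_fderiv, h1, h3.fderiv]
  simp only [add_apply, smul_apply, mulCoord_apply, SchwartzMap.lineDerivOp_apply_eq_fderiv]
  simp [real_inner_comm]
  ring

theorem polyDist_lineDeriv (p : MvPolynomial (Idx n) ℂ) (ν : Idx n) (f : TestFn n) :
    polyDist p (∂_{(basisVec ν : PhaseSpace n)} f) = - polyDist (MvPolynomial.pderiv ν p) f := by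
  induction p using MvPolynomial.induction_on generalizing f with
  | C c =>
    rw [polyDist_C, integral_lineDeriv, MvPolynomial.pderiv_C, ← MvPolynomial.C_0, polyDist_C]
    simp
  | add p q hp hq =>
    have h1 : ∀ p q : MvPolynomial (Idx n) ℂ, ∀ f,
        polyDist (p + q) f = polyDist p f + polyDist q f := fun p q f => by
      rw [polyDist_add]; rfl
    rw [map_add, h1, h1, hp, hq]; ring
  | mul_X p μ hp =>
    have h1 : ∀ p q : MvPolynomial (Idx n) ℂ, ∀ f,
        polyDist (p + q) f = polyDist p f + polyDist q f := fun p q f => by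
      rw [polyDist_add]; rfl
    have h2 := lineDeriv_mulCoord (basisVec ν) (basisVec μ) f
    have e : MvPolynomial.pderiv ν (p * MvPolynomial.X μ) =
        p * MvPolynomial.pderiv ν (MvPolynomial.X μ) +
          MvPolynomial.pderiv ν p * MvPolynomial.X μ := by
      rw [Derivation.leibniz, smul_eq_mul, smul_eq_mul, mul_comm (MvPolynomial.X μ)]
    rw [polyDist_mul_X, eq_sub_of_add_eq h2.symm, map_sub, map_smul, hp, e,
      h1, polyDist_mul_X, MvPolynomial.pderiv_X, smul_eq_mul]
    have h4 : inner ℝ (basisVec ν : PhaseSpace n) (basisVec μ) = if ν = μ then 1 else 0 :=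
      orthonormal_iff_ite.1 (EuclideanSpace.basisFun (Idx n) ℝ).orthonormal ν μ
    rw [h4]
    by_cases h : ν = μ
    · subst h
      simp
      ring
    · simp [h, polyDist_apply, polyFun]

theorem thetaInvEquiv_symm_basisVec (μ : Idx n) :
    (thetaInvEquiv n θ).symm (basisVec μ) = -∑ ν, Theta n θ μ ν • (basisVec ν : PhaseSpace n) := by
  have h1 : (thetaInvEquiv n θ).symm (basisVec μ) =
    Matrix.toEuclideanCLM (𝕜 := ℝ) (Theta n θ) (basisVec μ) := rfl
  rw [h1]
  ext κ
  have h2 := congrFun (congrFun (transpose_Theta n θ) μ) κ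
  simp only [Matrix.transpose_apply, Matrix.neg_apply] at h2
  have h3 : (Matrix.toEuclideanCLM (𝕜 := ℝ) (Theta n θ) (basisVec μ : PhaseSpace n)).ofLp κ =
      ((Theta n θ).mulVec (basisVec μ : PhaseSpace n).ofLp) κ := rfl
  rw [h3]
  simp [basisVec, h2, Pi.single_apply]

theorem lie_X_polyElem (μ : Idx n) (q : MvPolynomial (Idx n) ℂ) :
    ⁅polyElem n θ (MvPolynomial.X μ), polyElem n θ q⁆ =
      polyElem n θ (∑ ν, (Complex.I * (Theta n θ μ ν : ℂ)) • MvPolynomial.pderiv ν q) := by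
  refine moyal_ext fun f => ?_
  set u := (thetaInvEquiv n θ).symm (basisVec μ) with hu
  have h1 : toDist ⁅polyElem n θ (MvPolynomial.X μ), polyElem n θ q⁆ f =
      Complex.I * polyDist q (∂_{u} f) := by
    have : ⁅polyElem n θ (MvPolynomial.X μ), polyElem n θ q⁆ =
      coordMul u 1 * polyElem n θ q + (-1 : ℂ) • (polyElem n θ q * coordMul u 1) := by
      rw [Ring.lie_def, polyElem_X, neg_one_smul, sub_eq_add_neg]
    rw [this, toDist_add_apply, toDist_smul_apply, mul_coord_one, coord_one_mul, toDist_polyElem]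
    ring
  have h2 : ∂_{u} f = -∑ ν, (Theta n θ μ ν : ℂ) • (∂_{(basisVec ν : PhaseSpace n)} f : TestFn n) := by
    ext x
    rw [SchwartzMap.lineDerivOp_apply_eq_fderiv, hu, thetaInvEquiv_symm_basisVec]
    simp [SchwartzMap.lineDerivOp_apply_eq_fderiv]
  rw [h1, h2, map_neg, map_sum, map_sum]
  have h3 : toDist (∑ ν, polyElem n θ ((Complex.I * (Theta n θ μ ν : ℂ)) •
      MvPolynomial.pderiv ν q)) f =
      ∑ ν, Complex.I * (Theta n θ μ ν : ℂ) * polyDist (MvPolynomial.pderiv ν q) f := by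
    rw [map_sum]
    have : ∀ (s : Finset (Idx n)) (F : Idx n → 𝓢'(PhaseSpace n, ℂ)),
        (∑ ν ∈ s, F ν) f = ∑ ν ∈ s, F ν f := by
      intro s F
      classical
      induction s using Finset.induction_on with
      | empty => simp
      | insert i s hi ih => rw [Finset.sum_insert hi, Finset.sum_insert hi, add_apply, ih]
    rw [this]
    refine Finset.sum_congr rfl fun ν _ => ?_
    rw [map_smul, toDist_smul_apply, toDist_polyElem]
  rw [h3, ← Finset.sum_neg_distrib, Finset.mul_sum]
  refine Finset.sum_congr rfl fun ν _ => ?_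
  rw [map_smul, polyDist_lineDeriv, smul_eq_mul]
  ring

end Poly

end

end Moyal

namespace Moyal

noncomputable section

section Quadratic

variable {n : ℕ} {θ : ℝ} [NeZero θ]

theorem restrictTotalDegree_two_le (N : Submodule ℂ (MvPolynomial (Idx n) ℂ)) (h1 : 1 ∈ N)
    (hX : ∀ i, MvPolynomial.X i ∈ N) (hXX : ∀ i j, MvPolynomial.X i * MvPolynomial.X j ∈ N) :
    MvPolynomial.restrictTotalDegree (Idx n) ℂ 2 ≤ N := by
  intro p hp
  rw [MvPolynomial.mem_restrictTotalDegree] at hp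
  rw [← MvPolynomial.support_sum_monomial_coeff p]
  refine Submodule.sum_mem _ fun s hs => ?_
  have hdeg : (Finsupp.degree s) ≤ 2 := by
    have := MvPolynomial.le_totalDegree hs
    rw [Finsupp.degree_eq_sum]
    rw [Finsupp.sum_fintype _ _ (fun _ => rfl)] at this
    exact this.trans hp
  have key : ∀ s : Idx n →₀ ℕ, s ≠ 0 → ∃ i t, s = Finsupp.single i 1 + t := by
    intro s hs
    obtain ⟨i, hi⟩ := Finsupp.ne_iff.1 hs
    exact ⟨i, s - Finsupp.single i 1, (add_tsub_cancel_of_le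
      (Finsupp.single_le_iff.2 (Nat.one_le_iff_ne_zero.2 hi))).symm⟩
  suffices h : MvPolynomial.monomial s (1 : ℂ) ∈ N by
    have e : MvPolynomial.monomial s (p.coeff s) = p.coeff s • MvPolynomial.monomial s (1 : ℂ) := by
      rw [MvPolynomial.smul_monomial, smul_eq_mul, mul_one]
    rw [e]
    exact N.smul_mem _ h
  by_cases h0 : s = 0
  · subst h0
    exact h1
  · obtain ⟨i, t, rfl⟩ := key s h0
    rw [map_add, Finsupp.degree_single] at hdeg
    by_cases h2 : t = 0
    · subst h2
      rw [add_zero]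
      exact hX i
    · obtain ⟨j, r, rfl⟩ := key t h2
      rw [map_add, Finsupp.degree_single] at hdeg
      have h3 : r = 0 := (Finsupp.degree_eq_zero_iff r).1 (by omega)
      subst h3
      rw [add_zero]
      have e : MvPolynomial.monomial (Finsupp.single i 1 + Finsupp.single j 1) (1 : ℂ) =
          MvPolynomial.X i * MvPolynomial.X j := by
        rw [MvPolynomial.X, MvPolynomial.X, MvPolynomial.monomial_mul, mul_one]
      rw [e]
      exact hXX i j

variable (θ) in
/-- The derivation `q ↦ i Θ_{μν} ∂_ν q` of polynomials. -/
def hamil (μ : Idx n) : MvPolynomial (Idx n) ℂ →ₗ[ℂ] MvPolynomial (Idx n) ℂ :=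
  ∑ ν, (Complex.I * (Theta n θ μ ν : ℂ)) • (MvPolynomial.pderiv ν).toLinearMap

theorem hamil_apply (μ : Idx n) (q : MvPolynomial (Idx n) ℂ) : hamil θ μ q =
    ∑ ν, (Complex.I * (Theta n θ μ ν : ℂ)) • MvPolynomial.pderiv ν q := by
  simp [hamil, LinearMap.sum_apply]

theorem hamil_X (μ ν : Idx n) : hamil θ μ (MvPolynomial.X ν) =
    MvPolynomial.C (Complex.I * (Theta n θ μ ν : ℂ)) := by
  rw [hamil_apply, Finset.sum_eq_single ν]
  · simp [MvPolynomial.smul_eq_C_mul]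
  · intro κ _ h
    rw [MvPolynomial.pderiv_X_of_ne (Ne.symm h), smul_zero]
  · simp

theorem hamil_mul (μ : Idx n) (p q : MvPolynomial (Idx n) ℂ) :
    hamil θ μ (p * q) = hamil θ μ p * q + p * hamil θ μ q := by
  simp only [hamil_apply, Finset.sum_mul, Finset.mul_sum, ← Finset.sum_add_distrib]
  refine Finset.sum_congr rfl fun ν _ => ?_
  rw [Derivation.leibniz, smul_eq_mul, smul_eq_mul, smul_add, smul_mul_assoc, mul_smul_comm,
    mul_comm q]
  ring

theorem hamil_one (μ : Idx n) : hamil θ μ (1 : MvPolynomial (Idx n) ℂ) = 0 := by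
  rw [hamil_apply]
  simp

theorem lie_X (μ : Idx n) (q : MvPolynomial (Idx n) ℂ) :
    ⁅polyElem n θ (MvPolynomial.X μ), polyElem n θ q⁆ = polyElem n θ (hamil θ μ q) := by
  rw [lie_X_polyElem, hamil_apply]

theorem lie_XX (μ ν : Idx n) (q : MvPolynomial (Idx n) ℂ) :
    ⁅polyElem n θ (MvPolynomial.X μ * MvPolynomial.X ν), polyElem n θ q⁆ =
      polyElem n θ (hamil θ ν q * MvPolynomial.X μ + hamil θ μ q * MvPolynomial.X ν) := by
  rw [map_add, polyElem_mul_X', polyElem_mul_X', polyElem_mul_X', ← lie_X, ← lie_X]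
  simp only [Ring.lie_def, smul_mul_assoc, mul_smul_comm, ← smul_sub, ← smul_add]
  congr 1
  noncomm_ring

theorem hamil_mem (μ : Idx n) {q : MvPolynomial (Idx n) ℂ}
    (hq : q ∈ MvPolynomial.restrictTotalDegree (Idx n) ℂ 2) :
    hamil θ μ q ∈ MvPolynomial.restrictTotalDegree (Idx n) ℂ 1 := by
  have hC : ∀ (c : ℂ) (i : Idx n), MvPolynomial.C c * MvPolynomial.X i ∈
      MvPolynomial.restrictTotalDegree (Idx n) ℂ 1 := fun c i => by
    rw [MvPolynomial.mem_restrictTotalDegree]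
    refine (MvPolynomial.totalDegree_mul _ _).trans ?_
    rw [MvPolynomial.totalDegree_C, MvPolynomial.totalDegree_X]
  refine restrictTotalDegree_two_le
    ((MvPolynomial.restrictTotalDegree (Idx n) ℂ 1).comap (hamil θ μ)) ?_ ?_ ?_ hq
  · rw [Submodule.mem_comap, hamil_one]
    exact Submodule.zero_mem _
  · intro i
    rw [Submodule.mem_comap, hamil_X, MvPolynomial.mem_restrictTotalDegree,
      MvPolynomial.totalDegree_C]
    exact Nat.zero_le _
  · intro i j
    rw [Submodule.mem_comap, hamil_mul, hamil_X, hamil_X, mul_comm (MvPolynomial.X i)]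
    exact Submodule.add_mem _ (hC _ _) (hC _ _)

theorem mul_X_mem {q : MvPolynomial (Idx n) ℂ} (μ : Idx n)
    (hq : q ∈ MvPolynomial.restrictTotalDegree (Idx n) ℂ 1) :
    q * MvPolynomial.X μ ∈ MvPolynomial.restrictTotalDegree (Idx n) ℂ 2 := by
  rw [MvPolynomial.mem_restrictTotalDegree] at hq ⊢
  refine (MvPolynomial.totalDegree_mul _ _).trans ?_
  rw [MvPolynomial.totalDegree_X]
  omega

variable (n θ)

/-- The Lie algebra of polynomial functions of degree at most two, with the Moyal bracket. -/
def poly2 : LieSubalgebra ℂ (MoyalAlgebra n θ) where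
  toSubmodule := (MvPolynomial.restrictTotalDegree (Idx n) ℂ 2).map (polyElem n θ)
  lie_mem' := by
    rintro _ _ ⟨p, hp, rfl⟩ ⟨q, hq, rfl⟩
    change _ ∈ (MvPolynomial.restrictTotalDegree (Idx n) ℂ 2).map (polyElem n θ)
    rw [← lie_skew, Submodule.neg_mem_iff]
    refine restrictTotalDegree_two_le
      (((MvPolynomial.restrictTotalDegree (Idx n) ℂ 2).map (polyElem n θ)).comap
        ((LieAlgebra.ad ℂ (MoyalAlgebra n θ) (polyElem n θ q)) ∘ₗ polyElem n θ)) ?_ ?_ ?_ hp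
    · rw [Submodule.mem_comap, LinearMap.comp_apply, LieAlgebra.ad_apply, polyElem_one,
        Ring.lie_def, mul_one, one_mul, sub_self]
      exact Submodule.zero_mem _
    · intro i
      rw [Submodule.mem_comap, LinearMap.comp_apply, LieAlgebra.ad_apply, ← lie_skew,
        Submodule.neg_mem_iff, lie_X]
      have h1 := hamil_mem (θ := θ) i hq
      rw [MvPolynomial.mem_restrictTotalDegree] at h1
      refine Submodule.mem_map_of_mem ?_
      rw [MvPolynomial.mem_restrictTotalDegree]
      omega
    · intro i j
      rw [Submodule.mem_comap, LinearMap.comp_apply, LieAlgebra.ad_apply, ← lie_skew,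
        Submodule.neg_mem_iff, lie_XX]
      exact Submodule.mem_map_of_mem (Submodule.add_mem _ (mul_X_mem _ (hamil_mem _ hq))
        (mul_X_mem _ (hamil_mem _ hq)))

/-- The Lie algebra `𝒢₂ = ad 𝒫₂` of inner derivations of the Moyal algebra. -/
def G2 : LieSubalgebra ℂ (Module.End ℂ (MoyalAlgebra n θ)) :=
  (poly2 n θ).map (LieAlgebra.ad ℂ (MoyalAlgebra n θ))

variable {n θ}

/-- The inner derivation `ad P` for a polynomial `P` of degree at most two. -/
def adPoly (p : MvPolynomial (Idx n) ℂ)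
    (hp : p ∈ MvPolynomial.restrictTotalDegree (Idx n) ℂ 2) : G2 n θ :=
  ⟨LieAlgebra.ad ℂ (MoyalAlgebra n θ) (polyElem n θ p), polyElem n θ p, ⟨p, hp, rfl⟩, rfl⟩

theorem exists_adPoly_eq (X : G2 n θ) : ∃ p : MvPolynomial (Idx n) ℂ,
    ∃ hp : p ∈ MvPolynomial.restrictTotalDegree (Idx n) ℂ 2, adPoly p hp = X := by
  obtain ⟨_, _, ⟨p, hp, rfl⟩, rfl⟩ := X
  exact ⟨p, hp, rfl⟩

theorem G2_apply_mul (X : G2 n θ) (a b : MoyalAlgebra n θ) :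
    (X : Module.End ℂ (MoyalAlgebra n θ)) (a * b) =
      (X : Module.End ℂ (MoyalAlgebra n θ)) a * b + a * (X : Module.End ℂ (MoyalAlgebra n θ)) b := by
  obtain ⟨p, hp, rfl⟩ := exists_adPoly_eq X
  change ⁅polyElem n θ p, a * b⁆ = ⁅polyElem n θ p, a⁆ * b + a * ⁅polyElem n θ p, b⁆
  simp only [Ring.lie_def]
  noncomm_ring

theorem eq_C_of_pderiv_eq_zero {p : MvPolynomial (Idx n) ℂ}
    (h : ∀ ν, MvPolynomial.pderiv ν p = 0) : p = MvPolynomial.C (MvPolynomial.eval 0 p) := by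
  rw [MvPolynomial.eval_zero]
  ext s
  rw [MvPolynomial.coeff_C]
  split_ifs with hs
  · rw [← hs, MvPolynomial.constantCoeff_eq]
  · obtain ⟨i, hi⟩ := Finsupp.ne_iff.1 (Ne.symm hs)
    have h1 := MvPolynomial.coeff_pderiv (i := i) p (s - Finsupp.single i 1)
    rw [h i, tsub_add_cancel_of_le
      (Finsupp.single_le_iff.2 (Nat.one_le_iff_ne_zero.2 hi)), MvPolynomial.coeff_zero] at h1
    refine (mul_eq_zero.1 h1.symm).resolve_right ?_
    exact Nat.cast_add_one_ne_zero _

theorem eq_C_of_ad_eq_zero {p : MvPolynomial (Idx n) ℂ}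
    (h : LieAlgebra.ad ℂ (MoyalAlgebra n θ) (polyElem n θ p) = 0) :
    p = MvPolynomial.C (MvPolynomial.eval 0 p) := by
  have h1 : ∀ μ, hamil θ μ p = 0 := fun μ => by
    refine polyElem_injective (θ := θ) ?_
    rw [← lie_X, ← lie_skew, ← LieAlgebra.ad_apply ℂ, h, LinearMap.zero_apply, neg_zero, map_zero]
  refine eq_C_of_pderiv_eq_zero fun ν => ?_
  have h2 : ∑ μ, (ThetaInv n θ ν μ : ℂ) • hamil θ μ p =
      Complex.I • MvPolynomial.pderiv ν p := by
    have h3 : ∀ κ, ∑ μ, ThetaInv n θ ν μ * Theta n θ μ κ = if ν = κ then 1 else 0 := fun κ => by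
      rw [← Matrix.mul_apply, ThetaInv, Matrix.nonsing_inv_mul _ (isUnit_det_Theta n θ),
        Matrix.one_apply]
    simp only [hamil_apply, Finset.smul_sum, smul_smul]
    rw [Finset.sum_comm]
    simp only [← Finset.sum_smul]
    rw [Finset.sum_eq_single ν]
    · congr 1
      have := congrArg (fun r : ℝ => Complex.I * (r : ℂ)) (h3 ν)
      simp only [if_true, Complex.ofReal_one, mul_one, Complex.ofReal_sum, Complex.ofReal_mul,
        Finset.mul_sum] at this
      refine Eq.trans ?_ this
      exact Finset.sum_congr rfl fun _ _ => by ring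
    · intro κ _ hκ
      have := congrArg (fun r : ℝ => Complex.I * (r : ℂ)) (h3 κ)
      simp only [if_neg hκ.symm, Complex.ofReal_zero, mul_zero, Complex.ofReal_sum,
        Complex.ofReal_mul, Finset.mul_sum] at this
      have h4 : ∑ μ, (ThetaInv n θ ν μ : ℂ) * (Complex.I * (Theta n θ μ κ : ℂ)) = 0 := by
        rw [← this]
        exact Finset.sum_congr rfl fun _ _ => by ring
      rw [h4, zero_smul]
    · simp
  simp only [h1, smul_zero, Finset.sum_const_zero] at h2
  exact (smul_eq_zero.1 h2.symm).resolve_left Complex.I_ne_zero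

/-- A polynomial `P` with `X = ad P`. -/
def symbol (X : G2 n θ) : MvPolynomial (Idx n) ℂ := (exists_adPoly_eq X).choose

theorem ad_symbol (X : G2 n θ) :
    LieAlgebra.ad ℂ (MoyalAlgebra n θ) (polyElem n θ (symbol X)) = X :=
  congrArg Subtype.val (exists_adPoly_eq X).choose_spec.choose_spec

/-- `P - P(0)` does not depend on the choice of `P` with `X = ad P`. -/
theorem sub_C_eq {p q : MvPolynomial (Idx n) ℂ}
    (h : LieAlgebra.ad ℂ (MoyalAlgebra n θ) (polyElem n θ p) =
      LieAlgebra.ad ℂ (MoyalAlgebra n θ) (polyElem n θ q)) :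
    p - MvPolynomial.C (MvPolynomial.eval 0 p) = q - MvPolynomial.C (MvPolynomial.eval 0 q) := by
  have h1 := eq_C_of_ad_eq_zero (θ := θ) (p := p - q) (by rw [map_sub, map_sub, h, sub_self])
  rw [map_sub, map_sub] at h1
  linear_combination h1

variable (n θ)

/-- The linear map `η : 𝒢₂ → M`, `η (ad P) = P - P(0)`. -/
def eta : G2 n θ →ₗ[ℂ] MoyalAlgebra n θ where
  toFun X := polyElem n θ (symbol X - MvPolynomial.C (MvPolynomial.eval 0 (symbol X)))
  map_add' X Y := by
    rw [← map_add]
    congr 1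
    have h := sub_C_eq (θ := θ) (p := symbol (X + Y)) (q := symbol X + symbol Y) (by
      rw [map_add, map_add, ad_symbol, ad_symbol, ad_symbol]; rfl)
    rw [h, map_add, map_add]
    ring
  map_smul' c X := by
    rw [RingHom.id_apply, ← map_smul]
    congr 1
    have h := sub_C_eq (θ := θ) (p := symbol (c • X)) (q := c • symbol X) (by
      rw [map_smul, map_smul, ad_symbol, ad_symbol]; rfl)
    rw [h, MvPolynomial.smul_eval, map_mul, smul_sub, MvPolynomial.smul_eq_C_mul,
      MvPolynomial.smul_eq_C_mul]

theorem eta_adPoly (p : MvPolynomial (Idx n) ℂ)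
    (hp : p ∈ MvPolynomial.restrictTotalDegree (Idx n) ℂ 2) :
    eta n θ (adPoly p hp) = polyElem n θ (p - MvPolynomial.C (MvPolynomial.eval 0 p)) := by
  have h := sub_C_eq (θ := θ) (p := symbol (adPoly (θ := θ) p hp)) (q := p) (ad_symbol _)
  exact congrArg (polyElem n θ) h

/-- The linear function `ξ_μ = -Θ⁻¹_{μν} x_ν`. -/
def xi (μ : Idx n) : MvPolynomial (Idx n) ℂ :=
  -∑ ν, MvPolynomial.C (ThetaInv n θ μ ν : ℂ) * MvPolynomial.X ν

theorem totalDegree_xi (μ : Idx n) : (xi n θ μ).totalDegree ≤ 1 := by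
  rw [xi, MvPolynomial.totalDegree_neg]
  refine (MvPolynomial.totalDegree_finsetSum _ _).trans (Finset.sup_le fun ν _ => ?_)
  refine (MvPolynomial.totalDegree_mul _ _).trans ?_
  rw [MvPolynomial.totalDegree_C, MvPolynomial.totalDegree_X]

/-- The spatial derivation `∂_μ = ad (i ξ_μ)`. -/
def del (μ : Idx n) : G2 n θ :=
  adPoly (MvPolynomial.C Complex.I * xi n θ μ) (by
    rw [MvPolynomial.mem_restrictTotalDegree]
    refine (MvPolynomial.totalDegree_mul _ _).trans ?_
    have := totalDegree_xi n θ μ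
    rw [MvPolynomial.totalDegree_C]
    omega)

/-- The symplectic rotation `X_(μν) = ad (i ξ_μ ξ_ν)`. -/
def rot (μ ν : Idx n) : G2 n θ :=
  adPoly (MvPolynomial.C Complex.I * (xi n θ μ * xi n θ ν)) (by
    rw [MvPolynomial.mem_restrictTotalDegree]
    refine (MvPolynomial.totalDegree_mul _ _).trans ?_
    have h1 := MvPolynomial.totalDegree_mul (xi n θ μ) (xi n θ ν)
    have h2 := totalDegree_xi n θ μ
    have h3 := totalDegree_xi n θ ν
    rw [MvPolynomial.totalDegree_C]
    omega)

theorem rot_comm (μ ν : Idx n) : rot n θ μ ν = rot n θ ν μ := by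
  simp only [rot, mul_comm (xi n θ μ)]

end Quadratic

end

end Moyal

namespace Moyal

noncomputable section

section Connection

variable {A : Type*} [Ring A] [Algebra ℂ A]

/-- A noncommutative connection on the right module `A` over an algebra `A` with centre `ℂ`, for
the differential calculus based on a Lie algebra `𝔤` of derivations of `A`: a linear map
`X ↦ ∇_X` with `∇_X (m a) = m X(a) + ∇_X(m) a`. -/
structure NCConnection (𝔤 : LieSubalgebra ℂ (Module.End ℂ A)) where
  /-- The covariant derivatives `X ↦ ∇_X`. -/
  toLin : 𝔤 →ₗ[ℂ] Module.End ℂ A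
  leibniz : ∀ (X : 𝔤) (m a : A), toLin X (m * a) = m * (X : Module.End ℂ A) a + toLin X m * a

/-- The curvature `F(X, Y) = [∇_X, ∇_Y] - ∇_[X, Y]`. -/
def NCConnection.curvature {𝔤 : LieSubalgebra ℂ (Module.End ℂ A)} (D : NCConnection 𝔤)
    (X Y : 𝔤) : Module.End ℂ A :=
  ⁅D.toLin X, D.toLin Y⁆ - D.toLin ⁅X, Y⁆

variable (n : ℕ) (θ : ℝ) [NeZero θ]

/-- The canonical connection `∇^inv_X a = X(a) - η(X) ⋆ a`. -/
def canonicalConnection : NCConnection (G2 n θ) where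
  toLin := (G2 n θ).toSubmodule.subtype - LinearMap.mul ℂ (MoyalAlgebra n θ) ∘ₗ eta n θ
  leibniz X m a := by
    change (X : Module.End ℂ (MoyalAlgebra n θ)) (m * a) - eta n θ X * (m * a) =
      m * (X : Module.End ℂ (MoyalAlgebra n θ)) a +
        ((X : Module.End ℂ (MoyalAlgebra n θ)) m - eta n θ X * m) * a
    rw [G2_apply_mul]
    noncomm_ring

variable {n θ}

/-- The tensor form `𝒜(X) = A(X) + η(X)`, where `A(X) = ∇_X(1)`, of a connection. -/
def NCConnection.tensorForm (D : NCConnection (G2 n θ)) : G2 n θ →ₗ[ℂ] MoyalAlgebra n θ :=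
  D.toLin.flip 1 + eta n θ

end Connection

end

end Moyal

/-! All brackets are computed on polynomials in the linear forms `ξ_μ`, where Moyal commutators are
elementary. The formula `lie_X` for the commutator with a coordinate and `Θ⁻¹ Θ = 1` give `[ξ_μ, q]
= -i ∂q/∂x_μ` (`lie_xi`). The commutative product with `ξ_μ` is half the Moyal anticommutator
(`polyElem_mul_xi`). As commutators are derivations, `[ξ_μ ξ_ν, ·]` acts on polynomials as a
first-order operator with linear coefficients (`lie_xi_xi`). Together with `∂ξ_ν/∂x_μ = Θ⁻¹_{μν}`
this determines every bracket of the elements `i ξ_μ` and `i ξ_μ ξ_ν`.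

The map `η` is a linear section of `ad` (`ad_eta`), so `[η(X), η(Y)]` and `η([X, Y])` can differ
only by a constant. On the generators this constant is `i Θ⁻¹_{μν}` for two spatial derivations. It
vanishes for the other pairs, whose brackets are homogeneous of degree one or two in the `ξ`'s.
Applying `ad` forgets the constant and yields the commutation relations (`lie_G2_eq`); keeping it
yields the central term of the curvature.

The basis property is a statement about polynomials. Through `η` the family becomes `i ξ_μ`, `i ξ_μ
ξ_ν`, and the linear substitution `ξ_μ ↦ X_μ` turns these, up to the factor `i`, into distinct
monomials; independence follows because polynomials embed injectively in the Moyal algebra.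
Conversely, polynomials of degree at most two are spanned by `1` and the products of at most two
`ξ`'s, and `ad 1 = 0`.

The Leibniz rule with `m = 1` shows that a connection is determined by `∇_X(1)`, hence by its tensor
form, and adding a left multiplication to the canonical connection never spoils the rule. Since
`X(a) = η(X) a - a η(X)`, every connection reads `∇_X = L_{𝒜(X)} - R_{η(X)}`, with `L` and `R` left
and right multiplication (`toLin_apply_eq_sub`). Left and right multiplications commute, so the
curvature splits into the left multiplication by `[𝒜(X), 𝒜(Y)] - 𝒜([X, Y])` minus the right
multiplication by `[η(X), η(Y)] - η([X, Y])`. When the latter element is a scalar `c` it may be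
moved to the left, which is `curvature_eq`. The canonical connection is the case `𝒜 = 0`. -/

namespace Moyal

/-! ### Preliminaries on anticommutators and on the linear forms `ξ_μ`. -/

section LinearForms

/-- The bracket with `q` is a derivation, so it distributes over both factors of the anticommutator.
The terms are grouped into half anticommutators again, so that in `lie_xi_xi` each group can be read
as a commutative product of polynomials. -/
theorem lie_half_anticommutator {A : Type*} [Ring A] [Algebra ℂ A] (x y q : A) :
    ⁅(1 / 2 : ℂ) • (y * x + x * y), q⁆ =
      (1 / 2 : ℂ) • (x * ⁅y, q⁆ + ⁅y, q⁆ * x) + (1 / 2 : ℂ) • (y * ⁅x, q⁆ + ⁅x, q⁆ * y) := by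
  rw [smul_lie, ← smul_add]
  simp only [Ring.lie_def]
  congr 1
  noncomm_ring

variable {n : ℕ} {θ : ℝ}

theorem xi_eq_sum (μ : Idx n) :
    xi n θ μ = ∑ ν, (-ThetaInv n θ μ ν : ℂ) • MvPolynomial.X ν := by
  simp only [xi, MvPolynomial.C_mul', neg_smul, Finset.sum_neg_distrib]

theorem eval_zero_xi (μ : Idx n) : MvPolynomial.eval 0 (xi n θ μ) = 0 := by
  simp [xi]

end LinearForms

/-! ### Moyal brackets of the generators and the relations of `𝒢₂`. -/

section Commutators

variable {n : ℕ} {θ : ℝ} [NeZero θ]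

theorem sum_ThetaInv_mul_Theta (μ κ : Idx n) :
    ∑ ν, (ThetaInv n θ μ ν : ℂ) * (Theta n θ ν κ : ℂ) = if μ = κ then 1 else 0 := by
  have h : ∑ ν, ThetaInv n θ μ ν * Theta n θ ν κ = if μ = κ then 1 else 0 := by
    rw [← Matrix.mul_apply, ThetaInv, Matrix.nonsing_inv_mul _ (isUnit_det_Theta n θ),
      Matrix.one_apply]
  have h2 := congrArg (fun r : ℝ => (r : ℂ)) h
  simp only [Complex.ofReal_sum, Complex.ofReal_mul] at h2
  rw [h2]
  split_ifs <;> simp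

theorem sum_Theta_mul_ThetaInv (μ κ : Idx n) :
    ∑ ν, (Theta n θ μ ν : ℂ) * (ThetaInv n θ ν κ : ℂ) = if μ = κ then 1 else 0 := by
  have h : ∑ ν, Theta n θ μ ν * ThetaInv n θ ν κ = if μ = κ then 1 else 0 := by
    rw [← Matrix.mul_apply, ThetaInv, Matrix.mul_nonsing_inv _ (isUnit_det_Theta n θ),
      Matrix.one_apply]
  have h2 := congrArg (fun r : ℝ => (r : ℂ)) h
  simp only [Complex.ofReal_sum, Complex.ofReal_mul] at h2
  rw [h2]
  split_ifs <;> simp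

theorem ThetaInv_swap (μ ν : Idx n) : ThetaInv n θ ν μ = -ThetaInv n θ μ ν :=
  congrFun (congrFun (transpose_ThetaInv n θ) μ) ν

/-- Inverts `ξ = -Θ⁻¹ x`: the two minus signs cancel and `Θ Θ⁻¹ = 1`. It serves to show that the
`ξ`'s generate all polynomials when spanning is proved. -/
theorem X_eq_sum_xi (μ : Idx n) : (MvPolynomial.X μ : MvPolynomial (Idx n) ℂ) =
    ∑ ν, (-Theta n θ μ ν : ℂ) • xi n θ ν := by
  simp only [xi_eq_sum, Finset.smul_sum, smul_smul, neg_mul_neg]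
  rw [Finset.sum_comm]
  simp only [← Finset.sum_smul, sum_Theta_mul_ThetaInv]
  simp

/-- Only the `x_μ` term survives, with coefficient `-Θ⁻¹_{νμ}`; antisymmetry of `Θ⁻¹` absorbs the
sign and exchanges the indices. All structure constants below come from here. -/
theorem pderiv_xi (μ ν : Idx n) : MvPolynomial.pderiv μ (xi n θ ν) =
    MvPolynomial.C (ThetaInv n θ μ ν : ℂ) := by
  rw [xi, map_neg, map_sum, Finset.sum_eq_single μ]
  · rw [MvPolynomial.pderiv_C_mul, MvPolynomial.pderiv_X_self, mul_one, ThetaInv_swap ν μ]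
    simp
  · intro κ _ h
    rw [MvPolynomial.pderiv_C_mul, MvPolynomial.pderiv_X_of_ne h, mul_zero]
  · simp

theorem polyElem_xi (μ : Idx n) : polyElem n θ (xi n θ μ) =
    ∑ ν, (-ThetaInv n θ μ ν : ℂ) • polyElem n θ (MvPolynomial.X ν) := by
  rw [xi_eq_sum, map_sum]
  exact Finset.sum_congr rfl fun ν _ => map_smul _ _ _

/-- The bracket with `x_ν` is `i Θ_{νκ} ∂_κ`, and contracting with `-Θ⁻¹_{μν}` leaves `-i ∂_μ`. Thus
`ad (i ξ_μ)` really acts on polynomials as the partial derivative. -/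
theorem lie_xi (μ : Idx n) (q : MvPolynomial (Idx n) ℂ) :
    ⁅polyElem n θ (xi n θ μ), polyElem n θ q⁆ =
      polyElem n θ (MvPolynomial.C (-Complex.I) * MvPolynomial.pderiv μ q) := by
  have h : ∀ κ, ∑ ν, -(ThetaInv n θ μ ν : ℂ) * (Complex.I * (Theta n θ ν κ : ℂ)) =
      if μ = κ then -Complex.I else 0 := fun κ => by
    have := congrArg (fun z : ℂ => -Complex.I * z) (sum_ThetaInv_mul_Theta (θ := θ) μ κ)
    simp only [Finset.mul_sum, mul_ite, mul_one, mul_zero] at this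
    rw [← this]
    exact Finset.sum_congr rfl fun _ _ => by ring
  -- The operator `-i ∂_μ` is the combination of the derivations `hamil θ ν` with the same
  -- coefficients as `ξ_μ` in the coordinates, so `lie_X` can be applied term by term.
  have h' : MvPolynomial.C (-Complex.I) * MvPolynomial.pderiv μ q =
      ∑ ν, (-ThetaInv n θ μ ν : ℂ) • hamil θ ν q := by
    simp only [hamil_apply, Finset.smul_sum, smul_smul]
    rw [Finset.sum_comm]
    simp only [← Finset.sum_smul, h, MvPolynomial.C_mul']
    simp
  rw [h', polyElem_xi, sum_lie, map_sum]
  refine Finset.sum_congr rfl fun ν _ => ?_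
  rw [smul_lie, lie_X, map_smul]

/-- Both sides are linear in the second factor, so the formula for a coordinate, `polyElem_mul_X'`,
carries over to any linear form. -/
theorem polyElem_mul_xi (p : MvPolynomial (Idx n) ℂ) (μ : Idx n) :
    polyElem n θ (p * xi n θ μ) = (1 / 2 : ℂ) •
      (polyElem n θ (xi n θ μ) * polyElem n θ p + polyElem n θ p * polyElem n θ (xi n θ μ)) := by
  rw [polyElem_xi, xi_eq_sum, Finset.mul_sum, Finset.sum_mul, Finset.mul_sum,
    ← Finset.sum_add_distrib, Finset.smul_sum, map_sum]
  refine Finset.sum_congr rfl fun ν _ => ?_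
  rw [mul_smul_comm, map_smul, polyElem_mul_X', smul_mul_assoc, mul_smul_comm, ← smul_add,
    smul_comm]

/-- Write `ξ_μ ξ_ν` as a half anticommutator, apply the derivation `[·, q]` to each factor by
`lie_xi`, and read the resulting half anticommutators as commutative products. The outcome is exact:
there are no higher-order corrections in `θ`. -/
theorem lie_xi_xi (μ ν : Idx n) (q : MvPolynomial (Idx n) ℂ) :
    ⁅polyElem n θ (xi n θ μ * xi n θ ν), polyElem n θ q⁆ =
      polyElem n θ (MvPolynomial.C (-Complex.I) * MvPolynomial.pderiv ν q * xi n θ μ +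
        MvPolynomial.C (-Complex.I) * MvPolynomial.pderiv μ q * xi n θ ν) := by
  rw [map_add, polyElem_mul_xi, polyElem_mul_xi, polyElem_mul_xi, ← lie_xi, ← lie_xi]
  exact lie_half_anticommutator _ _ _

/-- The polynomial `i ξ_μ` has no constant term, so `η` leaves it as it is; the same holds for `i
ξ_μ ξ_ν` in `eta_rot`. -/
theorem eta_del (μ : Idx n) :
    eta n θ (del n θ μ) = Complex.I • polyElem n θ (xi n θ μ) := by
  rw [del, eta_adPoly, map_mul, eval_zero_xi, mul_zero, map_zero, sub_zero, MvPolynomial.C_mul',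
    map_smul]

theorem eta_rot (μ ν : Idx n) :
    eta n θ (rot n θ μ ν) = Complex.I • polyElem n θ (xi n θ μ * xi n θ ν) := by
  rw [rot, eta_adPoly, map_mul, map_mul (MvPolynomial.eval 0) (xi n θ μ), eval_zero_xi, zero_mul, mul_zero, map_zero, sub_zero,
    MvPolynomial.C_mul', map_smul]

/-- Every `X ∈ 𝒢₂` is the inner derivation by `η(X)`. -/
theorem ad_eta (X : G2 n θ) :
    LieAlgebra.ad ℂ (MoyalAlgebra n θ) (eta n θ X) = X := by
  obtain ⟨p, hp, rfl⟩ := exists_adPoly_eq X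
  refine LinearMap.ext fun a => ?_
  rw [eta_adPoly, map_sub, polyElem_C]
  rw [LieAlgebra.ad_apply]
  change _ = ⁅polyElem n θ p, a⁆
  -- The subtracted constant is a multiple of the unit, hence central, and drops out of the
  -- commutator.
  simp [Ring.lie_def, sub_mul, mul_sub]

theorem coe_lie_G2 (X Y : G2 n θ) : ((⁅X, Y⁆ : G2 n θ) : Module.End ℂ (MoyalAlgebra n θ)) =
    LieAlgebra.ad ℂ (MoyalAlgebra n θ) ⁅eta n θ X, eta n θ Y⁆ := by
  rw [LieHom.map_lie, ad_eta, ad_eta]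
  rfl

/-- Apply `ad` to the hypothesis: it sends `η(Z)` back to `Z` and kills the constant. Brackets in
`𝒢₂` therefore only need to be computed between the elements `η(X)`, and only modulo constants. -/
theorem lie_G2_eq {X Y Z : G2 n θ} {c : ℂ}
    (h : ⁅eta n θ X, eta n θ Y⁆ = eta n θ Z + c • 1) : ⁅X, Y⁆ = Z := by
  refine Subtype.ext (LinearMap.ext fun a => ?_)
  rw [coe_lie_G2, h, ← ad_eta Z]
  simp [Ring.lie_def]

/-- The Heisenberg relation, the source of the only nonzero constant: differentiating the linear
form `ξ_ν` leaves a scalar. The term `η(0)` is kept so that the equation has the shape required by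
`lie_G2_eq` and `curvature_eq`. -/
theorem lie_eta_del_del (μ ν : Idx n) : ⁅eta n θ (del n θ μ), eta n θ (del n θ ν)⁆ =
    eta n θ 0 + (Complex.I * (ThetaInv n θ μ ν : ℂ)) • 1 := by
  rw [eta_del, eta_del, smul_lie, lie_smul, lie_xi, pderiv_xi, ← map_mul, polyElem_C, smul_smul,
    smul_smul, map_zero, zero_add]
  congr 1
  -- The two factors `i` of the generators and the `-i` of `lie_xi` multiply to `i`.
  linear_combination (-Complex.I * ThetaInv n θ μ ν) * Complex.I_mul_I

/-- This is the product rule for `∂_μ (ξ_ρ ξ_σ)`. The result is homogeneous of degree one, so no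
constant appears and the equality holds in the Moyal algebra itself, not only modulo scalars. -/
theorem lie_eta_del_rot (μ ρ σ : Idx n) : ⁅eta n θ (del n θ μ), eta n θ (rot n θ ρ σ)⁆ =
    eta n θ ((ThetaInv n θ μ ρ : ℂ) • del n θ σ + (ThetaInv n θ μ σ : ℂ) • del n θ ρ) := by
  rw [eta_del, eta_rot, smul_lie, lie_smul, lie_xi, map_add, map_smul, map_smul, eta_del, eta_del]
  simp only [← map_smul, ← map_add]
  congr 1
  rw [Derivation.leibniz, pderiv_xi, pderiv_xi]
  simp only [MvPolynomial.smul_eq_C_mul, smul_eq_mul]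
  have h : (MvPolynomial.C Complex.I * MvPolynomial.C Complex.I : MvPolynomial (Idx n) ℂ) = -1 := by
    rw [← map_mul, Complex.I_mul_I, map_neg, map_one]
  rw [map_neg]
  -- The two sides differ by `-i ∂_μ(ξ_ρ ξ_σ)` times `i² + 1`; the bracket here is that derivative
  -- written out.
  linear_combination (-MvPolynomial.C Complex.I * (xi n θ ρ * MvPolynomial.C (ThetaInv n θ μ σ : ℂ)
    + xi n θ σ * MvPolynomial.C (ThetaInv n θ μ ρ : ℂ))) * h

/-- Each of the two derivatives in `lie_xi_xi` meets the product `ξ_ρ ξ_σ`, which gives the four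
terms. The overall minus sign comes from writing `Θ⁻¹_{νρ}` as `-Θ⁻¹_{ρν}`. The result is purely
quadratic, so again there is no constant. -/
theorem lie_eta_rot_rot (μ ν ρ σ : Idx n) :
    ⁅eta n θ (rot n θ μ ν), eta n θ (rot n θ ρ σ)⁆ =
      eta n θ (-((ThetaInv n θ ρ ν : ℂ) • rot n θ μ σ + (ThetaInv n θ σ ν : ℂ) • rot n θ μ ρ +
        (ThetaInv n θ ρ μ : ℂ) • rot n θ ν σ + (ThetaInv n θ σ μ : ℂ) • rot n θ ν ρ)) := by
  simp only [map_neg, map_add, map_smul, eta_rot, smul_lie, lie_smul, lie_xi_xi]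
  simp only [← map_smul, ← map_add, ← map_neg (polyElem n θ)]
  congr 1
  simp only [Derivation.leibniz, pderiv_xi]
  -- Antisymmetry brings the matrix entries of the right-hand side to the index order produced by
  -- `pderiv_xi`, with `μ` or `ν` first.
  simp only [MvPolynomial.smul_eq_C_mul, smul_eq_mul, ThetaInv_swap ν, ThetaInv_swap μ,
    Complex.ofReal_neg]
  have h : (MvPolynomial.C Complex.I * MvPolynomial.C Complex.I : MvPolynomial (Idx n) ℂ) = -1 := by
    rw [← map_mul, Complex.I_mul_I, map_neg, map_one]
  simp only [map_neg]
  linear_combination (-MvPolynomial.C Complex.I *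
    ((xi n θ ρ * MvPolynomial.C (ThetaInv n θ ν σ : ℂ)
      + xi n θ σ * MvPolynomial.C (ThetaInv n θ ν ρ : ℂ)) * xi n θ μ +
    (xi n θ ρ * MvPolynomial.C (ThetaInv n θ μ σ : ℂ)
      + xi n θ σ * MvPolynomial.C (ThetaInv n θ μ ρ : ℂ)) * xi n θ ν)) * h

theorem lie_del_del (μ ν : Idx n) : ⁅del n θ μ, del n θ ν⁆ = 0 := lie_G2_eq (lie_eta_del_del μ ν)

theorem lie_del_rot (μ ρ σ : Idx n) : ⁅del n θ μ, rot n θ ρ σ⁆ =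
    (ThetaInv n θ μ ρ : ℂ) • del n θ σ + (ThetaInv n θ μ σ : ℂ) • del n θ ρ :=
  lie_G2_eq (c := 0) (by rw [lie_eta_del_rot, zero_smul, add_zero])

theorem lie_rot_rot (μ ν ρ σ : Idx n) : ⁅rot n θ μ ν, rot n θ ρ σ⁆ =
    -((ThetaInv n θ ρ ν : ℂ) • rot n θ μ σ + (ThetaInv n θ σ ν : ℂ) • rot n θ μ ρ +
      (ThetaInv n θ ρ μ : ℂ) • rot n θ ν σ + (ThetaInv n θ σ μ : ℂ) • rot n θ ν ρ) :=
  lie_G2_eq (c := 0) (by rw [lie_eta_rot_rot, zero_smul, add_zero])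

end Commutators

/-! ### The basis of `𝒢₂`: reduction to linear independence and spanning for polynomials. -/

section Basis

variable (n : ℕ) (θ : ℝ) [NeZero θ]

/-- The exponents of the monomials `X_μ` and `X_μ X_ν`. -/
noncomputable def quadExponent : Idx n ⊕ Sym2 (Idx n) → (Idx n →₀ ℕ) :=
  Sum.elim (fun μ => Finsupp.single μ 1)
    (Sym2.lift ⟨fun μ ν => Finsupp.single μ 1 + Finsupp.single ν 1, fun _ _ => add_comm _ _⟩)

/-- A monomial of degree two remembers its unordered pair of variables, and the degree separates
linear from quadratic monomials. -/
theorem quadExponent_injective : Function.Injective (quadExponent n) := by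
  refine Function.Injective.sumElim (Finsupp.single_left_injective one_ne_zero) ?_ ?_
  · intro a b h
    induction a using Sym2.ind with | _ μ ν => ?_
    induction b using Sym2.ind with | _ ρ σ => ?_
    simp only [Sym2.lift_mk] at h
    rw [Finsupp.single_add_single_eq_single_add_single one_ne_zero one_ne_zero] at h
    rw [Sym2.eq_iff]
    rcases h with h | h | h
    · exact Or.inl h
    · exact Or.inr h.2
    -- The remaining alternative would require `1 + 1 = 0` in `ℕ`.
    · omega
  · intro μ b h
    induction b using Sym2.ind with | _ ρ σ => ?_
    -- The two exponents have degrees one and two.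
    have := congrArg Finsupp.degree h
    simp at this

/-- The substitution sending `ξ_μ` to `X_μ`. -/
noncomputable def xiToX : MvPolynomial (Idx n) ℂ →ₐ[ℂ] MvPolynomial (Idx n) ℂ :=
  MvPolynomial.aeval fun μ => ∑ ν, (-Theta n θ μ ν : ℂ) • MvPolynomial.X ν

theorem xiToX_xi (μ : Idx n) : xiToX n θ (xi n θ μ) = MvPolynomial.X μ := by
  simp only [xi, xiToX, map_neg, map_sum, MvPolynomial.aeval_X, MvPolynomial.C_mul',
    map_smul, Finset.smul_sum, neg_smul, smul_neg, Finset.sum_neg_distrib, neg_neg, smul_smul]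
  rw [Finset.sum_comm]
  simp only [← Finset.sum_smul, sum_ThetaInv_mul_Theta]
  simp

/-- The family of the `∂_μ` and the `X_(μν)`. -/
noncomputable def quadFamily : Idx n ⊕ Sym2 (Idx n) → G2 n θ :=
  Sum.elim (del n θ) (Sym2.lift ⟨rot n θ, rot_comm n θ⟩)

/-- Treats both kinds of generator uniformly, so that the independence proof can choose one
polynomial per index without a case distinction. -/
theorem exists_eta_quadFamily (i : Idx n ⊕ Sym2 (Idx n)) :
    ∃ p, eta n θ (quadFamily n θ i) = Complex.I • polyElem n θ p ∧
      xiToX n θ p = MvPolynomial.monomial (quadExponent n i) 1 := by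
  rcases i with μ | a
  · exact ⟨_, eta_del μ, xiToX_xi n θ μ⟩
  · induction a using Sym2.ind with | _ μ ν => ?_
    refine ⟨_, eta_rot μ ν, ?_⟩
    rw [map_mul, xiToX_xi, xiToX_xi, MvPolynomial.X, MvPolynomial.X, MvPolynomial.monomial_mul,
      mul_one]
    rfl

/-- Independence may be tested after applying a linear map. Here `η` leads to polynomials in the
`ξ`'s, and `xiToX` leads from these to distinct monomials. -/
theorem linearIndependent_quadFamily : LinearIndependent ℂ (quadFamily n θ) := by
  choose p hp hx using exists_eta_quadFamily n θ
  have h1 : LinearIndependent ℂ p := by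
    refine LinearIndependent.of_comp (xiToX n θ).toLinearMap ?_
    have e : (xiToX n θ).toLinearMap ∘ p =
        MvPolynomial.basisMonomials (Idx n) ℂ ∘ quadExponent n := by
      ext1 i
      simp [hx]
    rw [e]
    exact (MvPolynomial.basisMonomials (Idx n) ℂ).linearIndependent.comp _
      (quadExponent_injective n)
  have h2 : LinearIndependent ℂ (fun i => Complex.I • p i) :=
    h1.units_smul fun _ => Units.mk0 Complex.I Complex.I_ne_zero
  -- Independence must be pushed forward along the embedding of the polynomials, which is where its
  -- injectivity enters.
  have h3 := h2.map' (polyElem n θ) (LinearMap.ker_eq_bot.2 polyElem_injective)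
  have e : eta n θ ∘ quadFamily n θ = polyElem n θ ∘ fun i => Complex.I • p i :=
    funext fun i => (hp i).trans (map_smul _ _ _).symm
  exact LinearIndependent.of_comp (eta n θ) (e ▸ h3)

/-- The polynomials `P` with `ad P` in the span form a subspace. It suffices that this subspace
contains `1`, the coordinates and their pairwise products, by `restrictTotalDegree_two_le`. -/
theorem span_quadFamily : Submodule.span ℂ (Set.range (quadFamily n θ)) = ⊤ := by
  set S := Submodule.span ℂ (Set.range (quadFamily n θ)) with hS
  let N := (S.map (G2 n θ).toSubmodule.subtype).comap
    ((LieAlgebra.ad ℂ (MoyalAlgebra n θ) : MoyalAlgebra n θ →ₗ[ℂ] _) ∘ₗ polyElem n θ)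
  have hη : ∀ (X : G2 n θ) (p : MvPolynomial (Idx n) ℂ), X ∈ S →
      eta n θ X = Complex.I • polyElem n θ p → p ∈ N := fun X p hX hp => by
    -- The generators are `ad (i p)`, so membership is shown for `i p` and the factor `i` is divided
    -- out.
    refine (N.smul_mem_iff Complex.I_ne_zero).1 ?_
    refine ⟨X, hX, ?_⟩
    change (X : Module.End ℂ (MoyalAlgebra n θ)) = LieAlgebra.ad ℂ (MoyalAlgebra n θ) _
    rw [map_smul, ← hp, ad_eta]
  have hxi : ∀ μ, xi n θ μ ∈ N := fun μ =>
    hη _ _ (Submodule.subset_span ⟨Sum.inl μ, rfl⟩) (eta_del μ)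
  have hxixi : ∀ μ ν, xi n θ μ * xi n θ ν ∈ N := fun μ ν =>
    hη _ _ (Submodule.subset_span ⟨Sum.inr s(μ, ν), rfl⟩) (eta_rot μ ν)
  have hle : MvPolynomial.restrictTotalDegree (Idx n) ℂ 2 ≤ N := by
    refine restrictTotalDegree_two_le N ?_ ?_ ?_
    -- The unit is central, so its inner derivation is zero.
    · refine ⟨0, Submodule.zero_mem _, ?_⟩
      refine LinearMap.ext fun a => ?_
      change 0 = ⁅polyElem n θ 1, a⁆
      rw [polyElem_one, Ring.lie_def, one_mul, mul_one, sub_self]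
    · intro i
      rw [X_eq_sum_xi (θ := θ)]
      exact Submodule.sum_mem _ fun ν _ => N.smul_mem _ (hxi ν)
    · intro i j
      -- Expanding both coordinates in the `ξ`'s turns the product into a combination of the `ξ_μ
      -- ξ_ν`.
      rw [X_eq_sum_xi (θ := θ) i, X_eq_sum_xi (θ := θ) j, Finset.sum_mul_sum]
      refine Submodule.sum_mem _ fun μ _ => Submodule.sum_mem _ fun ν _ => ?_
      rw [smul_mul_smul_comm]
      exact N.smul_mem _ (hxixi μ ν)
  refine eq_top_iff.2 fun X _ => ?_
  obtain ⟨p, hp, rfl⟩ := exists_adPoly_eq X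
  obtain ⟨Y, hY, h⟩ := hle hp
  have : Y = adPoly p hp := Subtype.ext h
  exact this ▸ hY

end Basis

/-! ### Connections, their tensor forms and their curvature. -/

section Connections

variable {n : ℕ} {θ : ℝ} [NeZero θ]

theorem G2_apply_one (X : G2 n θ) : (X : Module.End ℂ (MoyalAlgebra n θ)) 1 = 0 := by
  simpa using G2_apply_mul X 1 1

theorem canonicalConnection_apply (X : G2 n θ) (a : MoyalAlgebra n θ) :
    (canonicalConnection n θ).toLin X a =
      (X : Module.End ℂ (MoyalAlgebra n θ)) a - eta n θ X * a := rfl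

namespace NCConnection

theorem tensorForm_apply (D : NCConnection (G2 n θ)) (X : G2 n θ) :
    D.tensorForm X = D.toLin X 1 + eta n θ X := rfl

/-- The Leibniz rule with `m = 1` gives `∇_X(a) = X(a) + ∇_X(1) a`; adding and subtracting `η(X) a`
separates the canonical connection from the tensor form. -/
theorem toLin_apply (D : NCConnection (G2 n θ)) (X : G2 n θ) (a : MoyalAlgebra n θ) :
    D.toLin X a = (canonicalConnection n θ).toLin X a + D.tensorForm X * a := by
  have h := D.leibniz X 1 a
  rw [one_mul, one_mul] at h
  rw [h, canonicalConnection_apply, tensorForm_apply, add_mul]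
  abel

/-- Since `X` is the commutator with `η(X)`, the canonical part reduces to `-a η(X)`. A covariant
derivative is thus a left multiplication minus a right multiplication, and these commute; this is
the form used for the curvature. -/
theorem toLin_apply_eq_sub (D : NCConnection (G2 n θ)) (X : G2 n θ) (a : MoyalAlgebra n θ) :
    D.toLin X a = D.tensorForm X * a - a * eta n θ X := by
  have h : (X : Module.End ℂ (MoyalAlgebra n θ)) a = eta n θ X * a - a * eta n θ X := by
    conv_lhs => rw [← ad_eta X]
    rw [LieAlgebra.ad_apply, Ring.lie_def]
  rw [toLin_apply, canonicalConnection_apply, h]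
  abel

theorem tensorForm_bijective :
    Function.Bijective fun D : NCConnection (G2 n θ) => D.tensorForm := by
  constructor
  · rintro D E h
    -- By `toLin_apply` the covariant derivatives depend on the connection only through its tensor
    -- form.
    have h1 : D.toLin = E.toLin := LinearMap.ext fun X => LinearMap.ext fun a => by
      rw [D.toLin_apply, E.toLin_apply]
      exact congrArg (fun A : G2 n θ →ₗ[ℂ] MoyalAlgebra n θ => _ + A X * a) h
    cases D
    cases E
    congr
  · intro A
    -- Left multiplication by `A(X)` is linear for the right module structure, so adding it
    -- preserves the Leibniz rule. As `X(1) = 0`, the tensor form of the sum is exactly `A`.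
    refine ⟨⟨(canonicalConnection n θ).toLin + LinearMap.mul ℂ (MoyalAlgebra n θ) ∘ₗ A,
      fun X m a => ?_⟩, LinearMap.ext fun X => ?_⟩
    · change (canonicalConnection n θ).toLin X (m * a) + A X * (m * a) =
        _ + ((canonicalConnection n θ).toLin X m + A X * m) * a
      rw [(canonicalConnection n θ).leibniz]
      noncomm_ring
    · change (X : Module.End ℂ (MoyalAlgebra n θ)) 1 - eta n θ X * 1 + A X * 1 + eta n θ X = A X
      rw [G2_apply_one, mul_one, mul_one]
      abel

/-- With `∇_X = L_{𝒜(X)} - R_{η(X)}` the mixed terms cancel. The right multiplications leave `-R` of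
`[η(X), η(Y)] - η([X, Y])`, which by hypothesis is the scalar `c` and so equals a left
multiplication. Hence the curvature is multiplication by an element of the algebra. -/
theorem curvature_eq (D : NCConnection (G2 n θ)) {X Y : G2 n θ} {c : ℂ}
    (h : ⁅eta n θ X, eta n θ Y⁆ = eta n θ ⁅X, Y⁆ + c • 1) :
    D.curvature X Y = LinearMap.mulLeft ℂ
      (⁅D.tensorForm X, D.tensorForm Y⁆ - D.tensorForm ⁅X, Y⁆ - c • 1) := by
  refine LinearMap.ext fun a => ?_
  have h1 : D.curvature X Y a =
    D.toLin X (D.toLin Y a) - D.toLin Y (D.toLin X a) - D.toLin ⁅X, Y⁆ a := rfl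
  -- Trades the right multiplication from `∇_[X, Y]` for the commutator arising from `[∇_X, ∇_Y]`,
  -- up to the scalar `c`; the rest is an identity valid in any ring.
  have h2 : a * eta n θ ⁅X, Y⁆ = a * ⁅eta n θ X, eta n θ Y⁆ - c • a := by
    rw [h, mul_add, mul_smul_comm, mul_one, add_sub_cancel_right]
  rw [h1]
  simp only [toLin_apply_eq_sub]
  have h3 : (c • (1 : MoyalAlgebra n θ)) * a = c • a := by rw [smul_mul_assoc, one_mul]
  rw [h2, LinearMap.mulLeft_apply, sub_mul (_ - _), h3, Ring.lie_def, Ring.lie_def]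
  noncomm_ring

/-- The spatial derivations commute while their images under `η` do not, so the whole defect `i
Θ⁻¹_{μν}` appears as a central term. -/
theorem curvature_del_del (D : NCConnection (G2 n θ)) (μ ν : Idx n) :
    D.curvature (del n θ μ) (del n θ ν) = LinearMap.mulLeft ℂ
      (⁅D.tensorForm (del n θ μ), D.tensorForm (del n θ ν)⁆ -
        (Complex.I * (ThetaInv n θ μ ν : ℂ)) • 1) := by
  rw [D.curvature_eq (by rw [lie_eta_del_del, lie_del_del]), lie_del_del, map_zero, sub_zero]

/-- On such pairs `η` respects brackets exactly, hence `c = 0`, and only the structure constants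
contribute besides the commutator. The same applies to `curvature_rot_rot`. -/
theorem curvature_del_rot (D : NCConnection (G2 n θ)) (μ ρ σ : Idx n) :
    D.curvature (del n θ μ) (rot n θ ρ σ) = LinearMap.mulLeft ℂ
      (⁅D.tensorForm (del n θ μ), D.tensorForm (rot n θ ρ σ)⁆ -
        (ThetaInv n θ μ ρ : ℂ) • D.tensorForm (del n θ σ) -
        (ThetaInv n θ μ σ : ℂ) • D.tensorForm (del n θ ρ)) := by
  rw [D.curvature_eq (c := 0) (by rw [lie_eta_del_rot, lie_del_rot, zero_smul, add_zero]),
    lie_del_rot, map_add, map_smul, map_smul, zero_smul, sub_zero, sub_add_eq_sub_sub]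

theorem curvature_rot_rot (D : NCConnection (G2 n θ)) (μ ν ρ σ : Idx n) :
    D.curvature (rot n θ μ ν) (rot n θ ρ σ) = LinearMap.mulLeft ℂ
      (⁅D.tensorForm (rot n θ μ ν), D.tensorForm (rot n θ ρ σ)⁆ +
        (ThetaInv n θ ρ ν : ℂ) • D.tensorForm (rot n θ μ σ) +
        (ThetaInv n θ σ ν : ℂ) • D.tensorForm (rot n θ μ ρ) +
        (ThetaInv n θ ρ μ : ℂ) • D.tensorForm (rot n θ ν σ) +
        (ThetaInv n θ σ μ : ℂ) • D.tensorForm (rot n θ ν ρ)) := by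
  rw [D.curvature_eq (c := 0) (by rw [lie_eta_rot_rot, lie_rot_rot, zero_smul, add_zero]),
    lie_rot_rot]
  simp only [map_neg, map_add, map_smul, zero_smul, sub_zero, sub_neg_eq_add, add_assoc]

end NCConnection

/-- Derivations kill `1`, so `∇^inv_X(1) = -η(X)`, which cancels the `η(X)` in the definition of the
tensor form. -/
theorem tensorForm_canonicalConnection : (canonicalConnection n θ).tensorForm = 0 :=
  LinearMap.ext fun X => by
    rw [NCConnection.tensorForm_apply, canonicalConnection_apply, G2_apply_one, mul_one, zero_sub,
      neg_add_cancel, LinearMap.zero_apply]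

end Connections

end Moyal

/-! ### The main theorem. -/

theorem mainTheorem1 (n : ℕ) (θ : ℝ) [NeZero θ] :
    -- `∂_μ` and the `X_(μν)`, `(μν)` unordered, form a basis of the Lie algebra `𝒢₂`,
    (LinearIndependent ℂ (Sum.elim (Moyal.del n θ)
        (Sym2.lift ⟨Moyal.rot n θ, Moyal.rot_comm n θ⟩)) ∧
      Submodule.span ℂ (Set.range (Sum.elim (Moyal.del n θ)
        (Sym2.lift ⟨Moyal.rot n θ, Moyal.rot_comm n θ⟩))) = ⊤) ∧
    -- with the commutation relations of the inhomogeneous symplectic Lie algebra;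
    ((∀ μ ν, ⁅Moyal.del n θ μ, Moyal.del n θ ν⁆ = 0) ∧
      (∀ μ ρ σ, ⁅Moyal.del n θ μ, Moyal.rot n θ ρ σ⁆ =
        (Moyal.ThetaInv n θ μ ρ : ℂ) • Moyal.del n θ σ +
          (Moyal.ThetaInv n θ μ σ : ℂ) • Moyal.del n θ ρ) ∧
      (∀ μ ν ρ σ, ⁅Moyal.rot n θ μ ν, Moyal.rot n θ ρ σ⁆ =
        -((Moyal.ThetaInv n θ ρ ν : ℂ) • Moyal.rot n θ μ σ +
          (Moyal.ThetaInv n θ σ ν : ℂ) • Moyal.rot n θ μ ρ +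
          (Moyal.ThetaInv n θ ρ μ : ℂ) • Moyal.rot n θ ν σ +
          (Moyal.ThetaInv n θ σ μ : ℂ) • Moyal.rot n θ ν ρ))) ∧
    -- connections correspond to tensor `1`-forms;
    (Function.Bijective fun D : Moyal.NCConnection (Moyal.G2 n θ) => D.tensorForm) ∧
    (∀ (D : Moyal.NCConnection (Moyal.G2 n θ)) (X : Moyal.G2 n θ) (a : Moyal.MoyalAlgebra n θ),
      D.toLin X a = (Moyal.canonicalConnection n θ).toLin X a + D.tensorForm X * a) ∧
    -- components of the curvature of a connection with tensor form `𝒜`;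
    (∀ D : Moyal.NCConnection (Moyal.G2 n θ),
      (∀ μ ν, D.curvature (Moyal.del n θ μ) (Moyal.del n θ ν) = LinearMap.mulLeft ℂ
        (⁅D.tensorForm (Moyal.del n θ μ), D.tensorForm (Moyal.del n θ ν)⁆ -
          (Complex.I * (Moyal.ThetaInv n θ μ ν : ℂ)) • 1)) ∧
      (∀ μ ρ σ, D.curvature (Moyal.del n θ μ) (Moyal.rot n θ ρ σ) = LinearMap.mulLeft ℂ
        (⁅D.tensorForm (Moyal.del n θ μ), D.tensorForm (Moyal.rot n θ ρ σ)⁆ -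
          (Moyal.ThetaInv n θ μ ρ : ℂ) • D.tensorForm (Moyal.del n θ σ) -
          (Moyal.ThetaInv n θ μ σ : ℂ) • D.tensorForm (Moyal.del n θ ρ))) ∧
      (∀ μ ν ρ σ, D.curvature (Moyal.rot n θ μ ν) (Moyal.rot n θ ρ σ) = LinearMap.mulLeft ℂ
        (⁅D.tensorForm (Moyal.rot n θ μ ν), D.tensorForm (Moyal.rot n θ ρ σ)⁆ +
          (Moyal.ThetaInv n θ ρ ν : ℂ) • D.tensorForm (Moyal.rot n θ μ σ) +
          (Moyal.ThetaInv n θ σ ν : ℂ) • D.tensorForm (Moyal.rot n θ μ ρ) +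
          (Moyal.ThetaInv n θ ρ μ : ℂ) • D.tensorForm (Moyal.rot n θ ν σ) +
          (Moyal.ThetaInv n θ σ μ : ℂ) • D.tensorForm (Moyal.rot n θ ν ρ)))) ∧
    -- curvature of the canonical connection.
    ((∀ μ ν, (Moyal.canonicalConnection n θ).curvature (Moyal.del n θ μ) (Moyal.del n θ ν) =
        LinearMap.mulLeft ℂ (-(Complex.I * (Moyal.ThetaInv n θ μ ν : ℂ)) • 1)) ∧
      (∀ μ ρ σ,
        (Moyal.canonicalConnection n θ).curvature (Moyal.del n θ μ) (Moyal.rot n θ ρ σ) = 0) ∧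
      (∀ μ ν ρ σ,
        (Moyal.canonicalConnection n θ).curvature (Moyal.rot n θ μ ν) (Moyal.rot n θ ρ σ) = 0)) := by
  refine ⟨⟨Moyal.linearIndependent_quadFamily n θ, Moyal.span_quadFamily n θ⟩,
    ⟨Moyal.lie_del_del, Moyal.lie_del_rot, Moyal.lie_rot_rot⟩,
    Moyal.NCConnection.tensorForm_bijective, Moyal.NCConnection.toLin_apply,
    fun D => ⟨D.curvature_del_del, D.curvature_del_rot, D.curvature_rot_rot⟩, ?_, ?_, ?_⟩
  -- With zero tensor form, each general curvature formula keeps only its constant term, which is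
  -- present here and absent in the two remaining cases.
  · intro μ ν
    rw [Moyal.NCConnection.curvature_del_del, Moyal.tensorForm_canonicalConnection]
    simp
  · intro μ ρ σ
    rw [Moyal.NCConnection.curvature_del_rot, Moyal.tensorForm_canonicalConnection]
    simp
  · intro μ ν ρ σ
    rw [Moyal.NCConnection.curvature_rot_rot, Moyal.tensorForm_canonicalConnection]
    simp
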